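/- All graphs are finite and connected, and multigraphs may have parallel edges. A (multi)graph is cubic if all its vertices have degree $3$, and bridgeless if it has no edge whose deletion disconnects it. (A bridgeless cubic multigraph has no loops.) A perfect matching of $G$ is the edge-set of a spanning subgraph of $G$ in which every vertex has degree $1$. An $S_4$-pair of $G$ is a pair of (not necessarily distinct) perfect matchings $M_1, M_2$ of $G$ such that deleting the edges of $M_1\cup M_2$ from $G$ leaves a bipartite graph. The frequency $\nu(e)\in\{0,1,2\}$ of an edge $e$ with respect to $(M_1,M_2)$ is the number of indices $t\in\{1,2\}$ with $e\in M_t$. The $S_4$-Conjecture is the assertion that every simple bridgeless cubic graph has an $S_4$-pair. Theorem. Let $i,j,k\in\{0,1,2\}$ be such that $i+j+k=2$. Then the $S_4$-Conjecture holds if and only if, for every bridgeless cubic multigraph $G'$, every vertex $w$ of $G'$ and every ordering $(a,b,c)$ of the three edges incident to $w$, there is an $S_4$-pair of $G'$ with $\nu(a)=i$, $\nu(b)=j$ and $\nu(c)=k$. -/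

import Mathlib

namespace Graph

variable {α β : Type*}

/-- The degree of a vertex of a (finite) multigraph; a loop contributes two. -/
noncomputable def degree (G : Graph α β) (x : α) : ℕ :=
  (G.incidenceSet x).ncard + (G.loopSet x).ncard

/-- Every vertex has degree three. -/
def IsCubic (G : Graph α β) : Prop :=
  ∀ x ∈ G.vertexSet, G.degree x = 3

/-- There is a walk in `G` from `x` to `y`. -/
def Reachable (G : Graph α β) (x y : α) : Prop :=
  Relation.ReflTransGen G.Adj x y

/-- A connected graph: it has a vertex, and any two vertices are joined by a walk. -/
def IsConnected (G : Graph α β) : Prop :=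
  G.vertexSet.Nonempty ∧ ∀ x ∈ G.vertexSet, ∀ y ∈ G.vertexSet, G.Reachable x y

/-- An edge `e` is a bridge if its deletion separates its ends from each other. -/
def IsBridge (G : Graph α β) (e : β) : Prop :=
  ∃ x y, G.IsLink e x y ∧ ¬ (G.deleteEdges {e}).Reachable x y

/-- Finite connected bridgeless cubic multigraphs. -/
structure IsBridgelessCubic (G : Graph α β) : Prop where
  finite_vertexSet : G.vertexSet.Finite
  finite_edgeSet : G.edgeSet.Finite
  connected : G.IsConnected
  bridgeless : ∀ e ∈ G.edgeSet, ¬ G.IsBridge e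
  cubic : G.IsCubic

/-- A perfect matching is the edge-set of a 1-factor, that is, of a spanning subgraph
in which every vertex has degree one. -/
def IsPerfectMatching (G : Graph α β) (M : Set β) : Prop :=
  M ⊆ G.edgeSet ∧ ∀ x ∈ G.vertexSet, (G.restrict M).degree x = 1

/-- The vertices can be 2-coloured so that the ends of each edge have different colours. -/
def Bipartite (G : Graph α β) : Prop :=
  ∃ c : α → Bool, ∀ e x y, G.IsLink e x y → c x ≠ c y

/-- Two (possibly equal) perfect matchings such that deleting their union
leaves a bipartite graph. -/
structure IsS4Pair (G : Graph α β) (M₁ M₂ : Set β) : Prop where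
  left : G.IsPerfectMatching M₁
  right : G.IsPerfectMatching M₂
  bipartite : (G.deleteEdges (M₁ ∪ M₂)).Bipartite

open Classical in
/-- The frequency of an edge `a` in a list of edge sets: the number of members of the list,
counted with multiplicity, that contain `a`. -/
noncomputable def frequency (L : List (Set β)) (a : β) : ℕ :=
  L.countP (fun M => a ∈ M)

/-- The `S₄`-Conjecture: every simple bridgeless cubic graph has an `S₄`-pair. -/
def S4Conjecture : Prop :=
  ∀ (α β : Type) (G : Graph α β), G.Simple → G.IsBridgelessCubic →
    ∃ M₁ M₂ : Set β, G.IsS4Pair M₁ M₂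

end Graph

/-!
The theorem compares the `S₄`-Conjecture for simple graphs with a strengthening for multigraphs in
which the frequencies at one vertex are prescribed. The strengthening trivially implies the
conjecture. For the converse, the arguments take place in a model in which the graph has darts
`V × Fin 3` and a fixed-point-free involution on them (`DartGraph`), so that graphs being cubic is
built in, and the absence of bridges and connectedness together say that a 2-colouring of the
vertices that is constant along all edges but one is constant. Three constructions do the work.

* `DartGraph.exists_isS4_of_isSimple`: simple graphs suffice for the plain existence of `S₄`-pairs
  in multigraphs. A digon (two parallel edges) is removed and the two edges leaving it are merged
  into one. An `S₄`-pair of the smaller graph always extends to the larger one: if both matchings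
  miss the merged edge, let them use the two different parallel edges.

* `DartGraph.exists_isS4_mem_both`: every edge `a` of `G` lies in both members of an `S₄`-pair.
  Replace all edges of the Petersen graph by chains of copies of `G` cut open at `a`. By parity a
  perfect matching uses both or neither end of each chain, so an `S₄`-pair induces two perfect
  matchings of the Petersen graph. These share an edge (`DartGraph.petersen_isPM_inter`), and a copy
  of `G` on that edge carries the required pair.

* `DartGraph.exists_isS4_one_one_zero`: the frequencies 1, 1, 0 can be prescribed at a vertex `w`.
  Replace `w` by the Petersen graph minus a vertex, and let `x` be the neighbour of the deleted
  vertex at which the edge of frequency 0 is attached. Take an `S₄`-pair whose members both contain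
  another edge at `x`. Each member then uses exactly one of the three edges leaving the inserted
  piece, and never the one at `x`; if both members used the same one, a 5-cycle of the Petersen
  graph would avoid both. In the formalization `x` is identified with `w`, so that only an 8-cycle
  with two chords is inserted.

Permuting the edges at `w`, these two prescriptions give all frequencies with sum two
(`DartGraph.exists_isS4_frequency`).
-/

/-! ### Cubic graphs presented by darts -/

/-- A 2-edge-connected cubic multigraph on the vertex type `V`, presented by its darts: the three
darts at `v` are `(v, 0)`, `(v, 1)`, `(v, 2)`, and the fixed-point-free involution `inv` pairs up
the two darts of each edge. Connectedness and the absence of bridges are expressed together: a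
2-colouring of the vertices that is constant along all edges with at most one exception is
constant. -/
structure DartGraph (V : Type) where
  /-- The dart at the other end of the same edge. -/
  inv : V × Fin 3 → V × Fin 3
  inv_inv : ∀ d, inv (inv d) = d
  inv_ne : ∀ d, inv d ≠ d
  const : ∀ d (f : V → Bool), (∀ d', d' ≠ d → d' ≠ inv d → f d'.1 = f (inv d').1) →
    ∀ u v, f u = f v

namespace DartGraph

variable {V : Type}

/-- A perfect matching, given by the function that selects the matching dart at every vertex. -/
def IsPM (G : DartGraph V) (m : V → Fin 3) : Prop :=
  ∀ d, m d.1 = d.2 → m (G.inv d).1 = (G.inv d).2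

/-- An `S₄`-pair: the edges outside both perfect matchings form a bipartite graph. -/
structure IsS4 (G : DartGraph V) (m₁ m₂ : V → Fin 3) : Prop where
  left : G.IsPM m₁
  right : G.IsPM m₂
  bipartite : ∃ c : V → Bool, ∀ d : V × Fin 3, m₁ d.1 ≠ d.2 → m₂ d.1 ≠ d.2 →
    c d.1 ≠ c (G.inv d).1

lemma IsPM.iff {G : DartGraph V} {m : V → Fin 3} (h : G.IsPM m) (d : V × Fin 3) :
    m (G.inv d).1 = (G.inv d).2 ↔ m d.1 = d.2 :=
  ⟨fun h' => by simpa [G.inv_inv] using h _ h', h d⟩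

lemma inv_eq_iff (G : DartGraph V) {d d' : V × Fin 3} : G.inv d = d' ↔ d = G.inv d' :=
  ⟨fun h => by rw [← h, G.inv_inv], fun h => by rw [h, G.inv_inv]⟩

/-- There are no loops: the third edge at a vertex carrying a loop would be a bridge. -/
lemma inv_fst_ne (G : DartGraph V) (d : V × Fin 3) : (G.inv d).1 ≠ d.1 := by
  classical
  obtain ⟨v, i⟩ := d
  intro h
  obtain ⟨j, hj⟩ : ∃ j, G.inv (v, i) = (v, j) := ⟨(G.inv (v, i)).2, Prod.ext h rfl⟩
  have hj' : G.inv (v, j) = (v, i) := by rw [← hj, G.inv_inv]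
  have hij : j ≠ i := fun e => G.inv_ne (v, i) (by rw [hj, e])
  obtain ⟨k, hki, hkj, hk⟩ : ∃ k, k ≠ i ∧ k ≠ j ∧ ∀ l, l = i ∨ l = j ∨ l = k := by
    clear hj hj' h
    revert i j; decide
  have hc := G.const (v, k) (fun x => decide (x = v)) (by
    rintro ⟨x, l⟩ h1 h2
    by_cases hx : x = v
    · subst hx
      rcases hk l with rfl | rfl | rfl
      · simp [hj]
      · simp [hj']
      · exact absurd rfl h1
    · have : (G.inv (x, l)).1 ≠ v := by
        intro hv
        obtain ⟨l', hl'⟩ : ∃ l', G.inv (x, l) = (v, l') := ⟨_, Prod.ext hv rfl⟩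
        have h3 := G.inv_eq_iff.1 hl'
        rcases hk l' with rfl | rfl | rfl
        · rw [hj] at h3; exact hx (congrArg Prod.fst h3)
        · rw [hj'] at h3; exact hx (congrArg Prod.fst h3)
        · exact h2 h3
      simp [hx, this])
  have h1 : (G.inv (v, k)).1 = v := by
    have := hc (G.inv (v, k)).1 v
    simpa using this
  obtain ⟨l, hl⟩ : ∃ l, G.inv (v, k) = (v, l) := ⟨_, Prod.ext h1 rfl⟩
  have h3 := G.inv_eq_iff.1 hl
  rcases hk l with rfl | rfl | rfl
  · rw [hj] at h3; exact hkj (congrArg Prod.snd h3)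
  · rw [hj'] at h3; exact hki (congrArg Prod.snd h3)
  · exact G.inv_ne _ hl

/-! ### Prescribing an edge common to both matchings -/

/-- Parity across a 2-edge-cut: a choice of a dart at each vertex that is closed under `inv` away
from one edge contains both darts of that edge or neither. Indeed, modulo 2, the number of darts
not chosen is even at each vertex, and the darts off the given edge cancel in pairs. -/
lemma mem_iff_inv_mem_of_matching_off_edge [Finite V] (G : DartGraph V) (a : V × Fin 3)
    (m : V → Fin 3)
    (h : ∀ d, d ≠ a → d ≠ G.inv a → m d.1 = d.2 → m (G.inv d).1 = (G.inv d).2) :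
    m a.1 = a.2 ↔ m (G.inv a).1 = (G.inv a).2 := by
  classical
  have := Fintype.ofFinite V
  let ψ : V × Fin 3 → ZMod 2 := fun d => if m d.1 = d.2 then 0 else 1
  have htot : ∑ d, ψ d = 0 := by
    have h3 : ∀ i : Fin 3, (if i = 0 then (0 : ZMod 2) else 1) + (if i = 1 then 0 else 1) +
        (if i = 2 then 0 else 1) = 0 := by decide
    rw [Fintype.sum_prod_type]
    exact Finset.sum_eq_zero fun v _ => by simpa only [ψ, Fin.sum_univ_three] using h3 (m v)
  have hrest : ∑ d ∈ (Finset.univ.erase a).erase (G.inv a), ψ d = 0 := by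
    refine Finset.sum_involution (fun d _ => G.inv d) ?_ (fun d _ _ => G.inv_ne d) ?_
      (fun d _ => G.inv_inv d)
    · intro d hd
      simp only [Finset.mem_erase, Finset.mem_univ, and_true] at hd
      have hiff : m (G.inv d).1 = (G.inv d).2 ↔ m d.1 = d.2 := by
        refine ⟨fun h' => ?_, h d hd.2 hd.1⟩
        have := h (G.inv d) (fun e => hd.1 (G.inv_eq_iff.1 e))
          (fun e => hd.2 (by rw [← G.inv_inv d, e, G.inv_inv])) h'
        rwa [G.inv_inv] at this
      simp only [ψ, hiff]
      split_ifs <;> decide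
    · intro d hd
      simp only [Finset.mem_erase, Finset.mem_univ, and_true] at hd ⊢
      exact ⟨fun e => hd.2 (by rw [← G.inv_inv d, e, G.inv_inv]),
        fun e => hd.1 (G.inv_eq_iff.1 e)⟩
  have h1 := Finset.add_sum_erase Finset.univ ψ (Finset.mem_univ a)
  have h2 := Finset.add_sum_erase (Finset.univ.erase a) ψ (a := G.inv a)
    (by simp [G.inv_ne])
  rw [hrest] at h2
  rw [← h2, htot] at h1
  simp only [ψ] at h1
  split_ifs at h1 with h3 h4 h4 <;> tauto

/-- The colouring argument for `edgeSubst`, in terms of the restrictions `g` and `h d` of a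
colouring to `P` and to the copy of `G` indexed by `d`. The exceptional edge belongs to the copy
indexed by `d₀`; it joins it to `P` or to another copy, or lies inside. -/
lemma edgeSubst_const {W : Type} (P : DartGraph W) (G : DartGraph V) (a : V × Fin 3)
    (g : W → Bool) (h : W × Fin 3 → V → Bool) (d₀ : W × Fin 3)
    (hin : ∀ d ≠ d₀, ∀ z, z ≠ a → z ≠ G.inv a → h d z.1 = h d (G.inv z).1)
    (hmid : ∀ d, d ≠ d₀ → d ≠ P.inv d₀ → h d (G.inv a).1 = h (P.inv d) (G.inv a).1)
    (hout : ∀ d ≠ d₀, g d.1 = h d a.1)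
    (hd₀ : ((g d₀.1 = h d₀ a.1 ∨ h d₀ (G.inv a).1 = h (P.inv d₀) (G.inv a).1) ∧
        ∀ z, z ≠ a → z ≠ G.inv a → h d₀ z.1 = h d₀ (G.inv z).1) ∨
      (g d₀.1 = h d₀ a.1 ∧ h d₀ (G.inv a).1 = h (P.inv d₀) (G.inv a).1 ∧
        ∃ z, ∀ z', z' ≠ a → z' ≠ G.inv a → z' ≠ z → z' ≠ G.inv z →
          h d₀ z'.1 = h d₀ (G.inv z').1)) :
    (∀ x, g x = g d₀.1) ∧ ∀ d v, h d v = g d₀.1 := by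
  have hcopy : ∀ d ≠ d₀, ∀ u v, h d u = h d v := fun d hd => G.const a (h d) (hin d hd)
  have hP' : ∀ d, d ≠ P.inv d₀ → P.inv d ≠ d₀ := fun d h e => h (P.inv_eq_iff.1 e)
  have hg : ∀ x, g x = g d₀.1 := fun x => P.const d₀ g (fun d h1 h2 => by
    rw [hout d h1, hout _ (hP' d h2), hcopy d h1 _ (G.inv a).1, hmid d h1 h2,
      hcopy _ (hP' d h2) a.1 (G.inv a).1]) x d₀.1
  have hh : ∀ d ≠ d₀, ∀ v, h d v = g d₀.1 := fun d hd v => by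
    rw [hcopy d hd v a.1, ← hout d hd, hg]
  have hlast : ∀ v, h d₀ v = g d₀.1 := by
    rcases hd₀ with ⟨h1, h2⟩ | ⟨h1, h2, z, hz⟩
    · have hc := G.const a (h d₀) h2
      intro v
      rcases h1 with h1 | h1
      · rw [h1]; exact hc _ _
      · rw [hc v (G.inv a).1, h1, hh _ (P.inv_ne d₀)]
    · rw [hh _ (P.inv_ne d₀)] at h2
      have hc := G.const z (h d₀) (fun z' h3 h4 => by
        by_cases h5 : z' = a
        · rw [h5, ← h1, h2]
        · by_cases h6 : z' = G.inv a
          · rw [h6, G.inv_inv, ← h1, h2]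
          · exact hz z' h5 h6 h3 h4)
      intro v
      rw [hc v a.1, h1]
  refine ⟨hg, fun d v => ?_⟩
  by_cases hd : d = d₀
  · rw [hd]; exact hlast v
  · exact hh d hd v

/-- Every edge of `P` is replaced by a chain of two copies of `G` with the edge of the dart `a`
cut open: the dart `d` of `P` is joined to the end `a` of the copy of `G` indexed by `d`, and the
ends `G.inv a` of the two copies indexed by `d` and `P.inv d` are joined to each other. Indexing
the copies by darts avoids choosing an orientation of the edges of `P`. -/
def edgeSubstInv {W : Type} [DecidableEq V] (P : DartGraph W) (G : DartGraph V) (a : V × Fin 3) :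
    (W ⊕ (W × Fin 3) × V) × Fin 3 → (W ⊕ (W × Fin 3) × V) × Fin 3
  | (.inl x, i) => (.inr ((x, i), a.1), a.2)
  | (.inr (d, y), j) =>
    if (y, j) = a then (.inl d.1, d.2)
    else if (y, j) = G.inv a then (.inr (P.inv d, y), j)
    else (.inr (d, (G.inv (y, j)).1), (G.inv (y, j)).2)

/-- The graph with involution `edgeSubstInv`. -/
def edgeSubst {W : Type} [DecidableEq V] (P : DartGraph W) (G : DartGraph V) (a : V × Fin 3) :
    DartGraph (W ⊕ (W × Fin 3) × V) where
  inv := edgeSubstInv P G a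
  inv_inv := by
    rintro ⟨x | ⟨d, y⟩, i⟩
    · simp [edgeSubstInv]
    · by_cases h1 : (y, i) = a
      · simp [edgeSubstInv, h1]
        simp [← h1]
      · by_cases h2 : (y, i) = G.inv a
        · simp [edgeSubstInv, h2, P.inv_inv, G.inv_ne]
        · have h3 : G.inv (y, i) ≠ a := fun e => h2 (G.inv_eq_iff.1 e)
          have h4 : G.inv (y, i) ≠ G.inv a := fun e => h1 (by
            rw [← G.inv_inv (y, i), e, G.inv_inv])
          simp [edgeSubstInv, h1, h2, h3, h4, G.inv_inv]
  inv_ne := by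
    rintro ⟨x | ⟨d, y⟩, i⟩
    · simp [edgeSubstInv]
    · by_cases h1 : (y, i) = a
      · simp [edgeSubstInv, h1]
      · by_cases h2 : (y, i) = G.inv a
        · simp [edgeSubstInv, h2, P.inv_ne, G.inv_ne]
        · have := G.inv_ne (y, i)
          simp only [edgeSubstInv, h1, h2, if_false]
          intro e
          simp only [Prod.mk.injEq, Sum.inr.injEq, true_and] at e
          exact this (Prod.ext e.1 e.2)
  const := by
    intro D f hf
    have hga := G.inv_ne a
    obtain ⟨d₀, h₁, h₂⟩ : ∃ d₀ : W × Fin 3, (∀ x, f (.inl x) = f (.inl d₀.1)) ∧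
        ∀ d v, f (.inr (d, v)) = f (.inl d₀.1) := by
      -- the hypothesis along the edges inside the copies, between two copies, and between a copy
      -- and `P`
      have hin : ∀ d z, z ≠ a → z ≠ G.inv a → (.inr (d, z.1), z.2) ≠ D →
          (.inr (d, z.1), z.2) ≠ edgeSubstInv P G a D →
          f (.inr (d, z.1)) = f (.inr (d, (G.inv z).1)) := by
        intro d z h1 h2 h3 h4
        simpa [edgeSubstInv, h1, h2] using hf (.inr (d, z.1), z.2) h3 h4
      have hmid : ∀ d, (.inr (d, (G.inv a).1), (G.inv a).2) ≠ D →
          (.inr (d, (G.inv a).1), (G.inv a).2) ≠ edgeSubstInv P G a D →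
          f (.inr (d, (G.inv a).1)) = f (.inr (P.inv d, (G.inv a).1)) := by
        intro d h3 h4
        simpa [edgeSubstInv, hga] using hf (.inr (d, (G.inv a).1), (G.inv a).2) h3 h4
      have hout : ∀ d : W × Fin 3, (.inl d.1, d.2) ≠ D →
          (.inl d.1, d.2) ≠ edgeSubstInv P G a D → f (.inl d.1) = f (.inr (d, a.1)) := by
        intro d h3 h4
        simpa [edgeSubstInv] using hf (.inl d.1, d.2) h3 h4
      clear hf
      -- `d₀` is the index of the copy to which the exceptional edge belongs
      have hcases : ∃ d₀ : W × Fin 3,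
          (D = (.inl d₀.1, d₀.2) ∧ edgeSubstInv P G a D = (.inr (d₀, a.1), a.2)) ∨
          (D = (.inr (d₀, a.1), a.2) ∧ edgeSubstInv P G a D = (.inl d₀.1, d₀.2)) ∨
          (D = (.inr (d₀, (G.inv a).1), (G.inv a).2) ∧
            edgeSubstInv P G a D = (.inr (P.inv d₀, (G.inv a).1), (G.inv a).2)) ∨
          ∃ z : V × Fin 3, z ≠ a ∧ z ≠ G.inv a ∧ D = (.inr (d₀, z.1), z.2) ∧
            edgeSubstInv P G a D = (.inr (d₀, (G.inv z).1), (G.inv z).2) := by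
        obtain ⟨x | ⟨d, y⟩, i⟩ := D
        · exact ⟨(x, i), .inl ⟨rfl, rfl⟩⟩
        · refine ⟨d, .inr ?_⟩
          by_cases h1 : (y, i) = a
          · subst h1; exact .inl ⟨rfl, by simp [edgeSubstInv]⟩
          · by_cases h2 : (y, i) = G.inv a
            · refine .inr (.inl ⟨by rw [← h2], ?_⟩)
              simp only [edgeSubstInv, h2, hga, if_true, if_false]
              rw [← h2]
            · exact .inr (.inr ⟨(y, i), h1, h2, rfl, by simp [edgeSubstInv, h1, h2]⟩)
      obtain ⟨d₀, hD⟩ := hcases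
      have hP := P.inv_ne d₀
      refine ⟨d₀, edgeSubst_const P G a (fun x => f (.inl x)) (fun d v => f (.inr (d, v))) d₀
        (fun d hd z h1 h2 => hin d z h1 h2 ?_ ?_) (fun d h1 h2 => hmid d ?_ ?_)
        (fun d h1 => hout d ?_ ?_) ?_⟩
      rotate_right
      · rcases hD with ⟨h3, h4⟩ | ⟨h3, h4⟩ | ⟨h3, h4⟩ | ⟨z, h1, h2, h3, h4⟩
        · exact .inl ⟨.inr (hmid _ (by grind) (by grind)),
            fun z h1 h2 => hin _ z h1 h2 (by grind) (by grind)⟩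
        · exact .inl ⟨.inr (hmid _ (by grind) (by grind)),
            fun z h1 h2 => hin _ z h1 h2 (by grind) (by grind)⟩
        · exact .inl ⟨.inl (hout _ (by grind) (by grind)),
            fun z h1 h2 => hin _ z h1 h2 (by grind) (by grind)⟩
        · have h5 : G.inv z ≠ a := fun e => h2 (G.inv_eq_iff.1 e)
          have h6 : G.inv z ≠ G.inv a := fun e => h1 (by rw [← G.inv_inv z, e, G.inv_inv])
          exact .inr ⟨hout _ (by grind) (by grind), hmid _ (by grind) (by grind), z,
            fun z' h5 h6 h7 h8 => hin _ z' h5 h6 (by grind) (by grind)⟩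
      all_goals
        clear hin hmid hout
        rcases hD with ⟨h3, h4⟩ | ⟨h3, h4⟩ | ⟨h3, h4⟩ | ⟨z', h5, h6, h3, h4⟩ <;> grind
    have hall : ∀ u, f u = f (.inl d₀.1) := by
      rintro (x | ⟨d, v⟩)
      · exact h₁ x
      · exact h₂ d v
    intro u v
    rw [hall u, hall v]

/-- The Petersen graph: an outer 5-cycle on the vertices `(false, i)`, an inner pentagram on the
vertices `(true, i)`, and a spoke, which consists of the darts with index 2, for every `i`. -/
def petersenInv : (Bool × Fin 5) × Fin 3 → (Bool × Fin 5) × Fin 3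
  | ((b, i), 0) => ((b, if b then i + 2 else i + 1), 1)
  | ((b, i), 1) => ((b, if b then i - 2 else i - 1), 0)
  | ((b, i), 2) => ((!b, i), 2)

lemma petersen_const (d : (Bool × Fin 5) × Fin 3) (f : Bool × Fin 5 → Bool)
    (h : ∀ d', d' ≠ d → d' ≠ petersenInv d → f d'.1 = f (petersenInv d').1) :
    ∀ u v, f u = f v := by
  have hcyc : ∀ x₀ x₁ x₂ x₃ x₄ : Bool, ∀ i : Fin 5, (i ≠ 0 → x₀ = x₁) → (i ≠ 1 → x₁ = x₂) →
      (i ≠ 2 → x₂ = x₃) → (i ≠ 3 → x₃ = x₄) → (i ≠ 4 → x₄ = x₀) →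
      x₁ = x₀ ∧ x₂ = x₀ ∧ x₃ = x₀ ∧ x₄ = x₀ := by
    intro x₀ x₁ x₂ x₃ x₄ i
    fin_cases i <;> simp +contextual
  -- at most one edge of each 5-cycle is exceptional
  have hnext : ∀ b, ∃ i₀, ∀ i, i ≠ i₀ → ((b, i), 0) ≠ d ∧ ((b, i), 0) ≠ petersenInv d := by
    clear h
    revert d; decide
  have hspoke : ∃ i : Fin 5, ((false, i), 2) ≠ d ∧ ((false, i), 2) ≠ petersenInv d := by
    clear h hnext
    revert d; decide
  have hout : ∀ i, f (false, i) = f (false, 0) := by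
    obtain ⟨i₀, hi₀⟩ := hnext false
    have h' : ∀ i, i ≠ i₀ → f (false, i) = f (false, i + 1) := fun i hi =>
      h _ (hi₀ i hi).1 (hi₀ i hi).2
    have := hcyc _ _ _ _ _ i₀ (fun e => h' 0 e.symm) (fun e => h' 1 e.symm)
      (fun e => h' 2 e.symm) (fun e => h' 3 e.symm) (fun e => h' 4 e.symm)
    intro i
    fin_cases i
    exacts [rfl, this.1, this.2.1, this.2.2.1, this.2.2.2]
  have hinn : ∀ i, f (true, i) = f (true, 0) := by
    obtain ⟨i₀, hi₀⟩ := hnext true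
    have h' : ∀ i, i ≠ i₀ → f (true, i) = f (true, i + 2) := fun i hi =>
      h _ (hi₀ i hi).1 (hi₀ i hi).2
    -- the pentagram visits the vertices in the order 0, 2, 4, 1, 3, so that `i₀` is visited at
    -- position `i₀ / 2 = i₀ * 3` modulo 5
    have hi : ∀ j, i₀ * 3 ≠ j → 2 * j ≠ i₀ := by
      clear h' hi₀
      revert i₀; decide
    have := hcyc (f (true, 0)) (f (true, 2)) (f (true, 4)) (f (true, 1)) (f (true, 3)) (i₀ * 3)
      (fun e => h' 0 (hi 0 e)) (fun e => h' 2 (hi 1 e)) (fun e => h' 4 (hi 2 e))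
      (fun e => h' 1 (hi 3 e)) (fun e => h' 3 (hi 4 e))
    intro i
    fin_cases i
    exacts [rfl, this.2.2.1, this.1, this.2.2.2, this.2.1]
  obtain ⟨i, hi⟩ := hspoke
  have hs : f (false, i) = f (true, i) := h ((false, i), 2) hi.1 hi.2
  have hall : ∀ u, f u = f (false, 0) := by
    rintro ⟨b, j⟩
    cases b
    · exact hout j
    · rw [hinn j, ← hinn i, ← hs, hout i]
  intro u v
  rw [hall u, hall v]

/-- The Petersen graph. -/
def petersen : DartGraph (Bool × Fin 5) where
  inv := petersenInv
  inv_inv := by decide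
  inv_ne := by decide
  const := petersen_const

/-- The perfect matchings of the Petersen graph: all five spokes, or a single spoke together with
two edges of each 5-cycle. -/
def petersenPM : Option (Fin 5) → Bool × Fin 5 → Fin 3
  | none, _ => 2
  | some i, (b, j) => if b then ![2, 0, 0, 1, 1] (j - i) else ![2, 0, 1, 0, 1] (j - i)

set_option synthInstance.maxHeartbeats 400000 in
set_option synthInstance.maxSize 4000 in
lemma eq_petersenPM {m : Bool × Fin 5 → Fin 3} (h : petersen.IsPM m) :
    ∃ k, ∀ x, m x = petersenPM k x := by
  have hstep : ∀ x, m x = 0 ↔ m (petersenInv (x, 0)).1 = 1 := by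
    rintro ⟨b, i⟩
    exact (h.iff ((b, i), 0)).symm
  have hspoke : ∀ i, m (false, i) = 2 ↔ m (true, i) = 2 := fun i => (h.iff ((false, i), 2)).symm
  have key : ∀ o₀ o₁ : Fin 3, (o₀ = 0 ↔ o₁ = 1) → ∀ o₂ : Fin 3, (o₁ = 0 ↔ o₂ = 1) →
      ∀ o₃ : Fin 3, (o₂ = 0 ↔ o₃ = 1) → ∀ o₄ : Fin 3, (o₃ = 0 ↔ o₄ = 1) → (o₄ = 0 ↔ o₀ = 1) →
      ∀ n₀ : Fin 3, (o₀ = 2 ↔ n₀ = 2) → ∀ n₂ : Fin 3, (o₂ = 2 ↔ n₂ = 2) → (n₀ = 0 ↔ n₂ = 1) →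
      ∀ n₄ : Fin 3, (o₄ = 2 ↔ n₄ = 2) → (n₂ = 0 ↔ n₄ = 1) →
      ∀ n₁ : Fin 3, (o₁ = 2 ↔ n₁ = 2) → (n₄ = 0 ↔ n₁ = 1) →
      ∀ n₃ : Fin 3, (o₃ = 2 ↔ n₃ = 2) → (n₁ = 0 ↔ n₃ = 1) → (n₃ = 0 ↔ n₀ = 1) →
      ∃ k, (o₀ = petersenPM k (false, 0) ∧ o₁ = petersenPM k (false, 1) ∧
        o₂ = petersenPM k (false, 2) ∧ o₃ = petersenPM k (false, 3) ∧
        o₄ = petersenPM k (false, 4)) ∧ n₀ = petersenPM k (true, 0) ∧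
        n₁ = petersenPM k (true, 1) ∧ n₂ = petersenPM k (true, 2) ∧
        n₃ = petersenPM k (true, 3) ∧ n₄ = petersenPM k (true, 4) := by
    decide
  obtain ⟨k, ⟨h0, h1, h2, h3, h4⟩, h5, h6, h7, h8, h9⟩ :=
    key _ _ (hstep (false, 0)) _ (hstep (false, 1)) _ (hstep (false, 2)) _ (hstep (false, 3))
      (hstep (false, 4)) _ (hspoke 0) _ (hspoke 2) (hstep (true, 0)) _ (hspoke 4)
      (hstep (true, 2)) _ (hspoke 1) (hstep (true, 4)) _ (hspoke 3) (hstep (true, 1))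
      (hstep (true, 3))
  refine ⟨k, ?_⟩
  rintro ⟨b, i⟩
  cases b <;> fin_cases i <;> assumption

/-- Any two perfect matchings of the Petersen graph share an edge. -/
lemma petersen_isPM_inter {m₁ m₂ : Bool × Fin 5 → Fin 3} (h₁ : petersen.IsPM m₁)
    (h₂ : petersen.IsPM m₂) : ∃ x, m₁ x = m₂ x := by
  obtain ⟨k₁, h₁⟩ := eq_petersenPM h₁
  obtain ⟨k₂, h₂⟩ := eq_petersenPM h₂
  simp only [h₁, h₂]
  clear h₁ h₂
  revert k₁ k₂
  decide

/-- If every graph has an `S₄`-pair, then every edge lies in both members of some `S₄`-pair.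
Replace each edge of the Petersen graph by copies of `G` with that edge cut open. By parity, an
`S₄`-pair of the result induces two perfect matchings of the Petersen graph, and the copies of `G`
on a common edge of these carry the required pair. -/
lemma exists_isS4_mem_both [Finite V]
    (hS : ∀ (W : Type) [Finite W] [Nonempty W] (H : DartGraph W), ∃ m₁ m₂, H.IsS4 m₁ m₂)
    (G : DartGraph V) (a : V × Fin 3) :
    ∃ m₁ m₂, G.IsS4 m₁ m₂ ∧ m₁ a.1 = a.2 ∧ m₂ a.1 = a.2 := by
  classical
  obtain ⟨m₁, m₂, hm₁, hm₂, c, hc⟩ := hS _ (edgeSubst petersen G a)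
  have hga := G.inv_ne a
  -- the restriction of a perfect matching to a copy of `G`, away from the edge that is cut open
  have hin : ∀ m, (edgeSubst petersen G a).IsPM m → ∀ d z, z ≠ a → z ≠ G.inv a →
      m (.inr (d, z.1)) = z.2 → m (.inr (d, (G.inv z).1)) = (G.inv z).2 := by
    intro m hm d z h1 h2 h3
    simpa [edgeSubst, edgeSubstInv, h1, h2] using hm (.inr (d, z.1), z.2) h3
  have hout : ∀ m, (edgeSubst petersen G a).IsPM m → ∀ d : (Bool × Fin 5) × Fin 3,
      m (.inr (d, a.1)) = a.2 ↔ m (.inl d.1) = d.2 := by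
    intro m hm d
    simpa [edgeSubst, edgeSubstInv] using hm.iff (.inl d.1, d.2)
  have hpar : ∀ m, (edgeSubst petersen G a).IsPM m → ∀ d,
      m (.inr (d, a.1)) = a.2 ↔ m (.inr (d, (G.inv a).1)) = (G.inv a).2 := fun m hm d =>
    G.mem_iff_inv_mem_of_matching_off_edge a (fun v => m (.inr (d, v))) (hin m hm d)
  have hmid : ∀ m, (edgeSubst petersen G a).IsPM m → ∀ d,
      m (.inr (d, (G.inv a).1)) = (G.inv a).2 →
        m (.inr (petersen.inv d, (G.inv a).1)) = (G.inv a).2 := by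
    intro m hm d h
    simpa [edgeSubst, edgeSubstInv, hga] using hm (.inr (d, (G.inv a).1), (G.inv a).2) h
  have hP : ∀ m, (edgeSubst petersen G a).IsPM m → petersen.IsPM fun x => m (.inl x) := by
    intro m hm d hd
    exact (hout m hm _).1 ((hpar m hm _).2 (hmid m hm d ((hpar m hm d).1 ((hout m hm d).2 hd))))
  obtain ⟨x, hx⟩ := petersen_isPM_inter (hP m₁ hm₁) (hP m₂ hm₂)
  have hG : ∀ m, (edgeSubst petersen G a).IsPM m → ∀ d : (Bool × Fin 5) × Fin 3,
      m (.inl d.1) = d.2 → G.IsPM fun v => m (.inr (d, v)) := by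
    intro m hm d hd z hz
    by_cases h1 : z = a
    · subst h1; exact (hpar m hm d).1 hz
    · by_cases h2 : z = G.inv a
      · subst h2; rw [G.inv_inv]; exact (hpar m hm d).2 hz
      · exact hin m hm d z h1 h2 hz
  have ha₁ := (hout m₁ hm₁ (x, m₁ (.inl x))).2 rfl
  have ha₂ := (hout m₂ hm₂ (x, m₁ (.inl x))).2 hx.symm
  refine ⟨_, _, ⟨hG m₁ hm₁ (x, m₁ (.inl x)) rfl, hG m₂ hm₂ (x, m₁ (.inl x)) hx.symm,
    fun v => c (.inr ((x, m₁ (.inl x)), v)), fun z h1 h2 => ?_⟩, ha₁, ha₂⟩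
  have h3 : z ≠ a := by rintro rfl; exact h1 ha₁
  have h4 : z ≠ G.inv a := by rintro rfl; exact h1 ((hpar m₁ hm₁ _).1 ha₁)
  simpa [edgeSubst, edgeSubstInv, h3, h4] using hc (.inr ((x, m₁ (.inl x)), z.1), z.2) h1 h2

end DartGraph

/-! ### Prescribing the frequencies 1, 1, 0 at a vertex -/

namespace DartGraph

variable {V : Type}

/-- The involution of the graph obtained by inserting into the edges of the darts `A` and `B` (with
distinct indices at one vertex `w`) the 4-pole left when two adjacent vertices are deleted from the
Petersen graph. It is an 8-cycle with the chords `15` and `37`; its vertices `2` and `6` are joined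
to `w`, its vertices `0` and `4` to the other ends of the two edges. Equivalently, `w` is replaced
by the Petersen graph minus a vertex. -/
def insertPoleInv [DecidableEq V] (G : DartGraph V) (A B : V × Fin 3) :
    (V ⊕ Fin 8) × Fin 3 → (V ⊕ Fin 8) × Fin 3
  | (.inl v, i) =>
    if (v, i) = A then (.inr 2, 2)
    else if (v, i) = B then (.inr 6, 2)
    else if (v, i) = G.inv A then (.inr 0, 2)
    else if (v, i) = G.inv B then (.inr 4, 2)
    else (.inl (G.inv (v, i)).1, (G.inv (v, i)).2)
  | (.inr n, 0) => (.inr (n + 1), 1)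
  | (.inr n, 1) => (.inr (n - 1), 0)
  | (.inr 0, 2) => (.inl (G.inv A).1, (G.inv A).2)
  | (.inr 1, 2) => (.inr 5, 2)
  | (.inr 2, 2) => (.inl A.1, A.2)
  | (.inr 3, 2) => (.inr 7, 2)
  | (.inr 4, 2) => (.inl (G.inv B).1, (G.inv B).2)
  | (.inr 5, 2) => (.inr 1, 2)
  | (.inr 6, 2) => (.inl B.1, B.2)
  | (.inr 7, 2) => (.inr 3, 2)

lemma eq_of_eight_cycle (n₀ : Fin 8) (g : Fin 8 → Bool) (h : ∀ n, n ≠ n₀ → g n = g (n + 1)) :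
    ∀ n, g n = g 0 := by
  have h0 : 0 ≠ n₀ → g 0 = g 1 := h 0
  have h1 : 1 ≠ n₀ → g 1 = g 2 := h 1
  have h2 : 2 ≠ n₀ → g 2 = g 3 := h 2
  have h3 : 3 ≠ n₀ → g 3 = g 4 := h 3
  have h4 : 4 ≠ n₀ → g 4 = g 5 := h 4
  have h5 : 5 ≠ n₀ → g 5 = g 6 := h 5
  have h6 : 6 ≠ n₀ → g 6 = g 7 := h 6
  have h7 : 7 ≠ n₀ → g 7 = g 0 := h 7
  clear h
  intro n
  fin_cases n₀ <;> fin_cases n <;> simp_all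

lemma inv_ne_of_fst (G : DartGraph V) (w : V) (i j : Fin 3) : G.inv (w, i) ≠ (w, j) := fun e =>
  G.inv_fst_ne (w, i) (by rw [e])

section

variable [DecidableEq V] (G : DartGraph V) (w : V) {a b : Fin 3}

lemma insertPoleInv_left : insertPoleInv G (w, a) (w, b) (.inl w, a) = (.inr 2, 2) := by
  simp [insertPoleInv]

lemma insertPoleInv_right (hab : a ≠ b) :
    insertPoleInv G (w, a) (w, b) (.inl w, b) = (.inr 6, 2) := by
  simp [insertPoleInv, hab.symm]

lemma insertPoleInv_inv_left :
    insertPoleInv G (w, a) (w, b) (.inl (G.inv (w, a)).1, (G.inv (w, a)).2) = (.inr 0, 2) := by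
  simp [insertPoleInv, inv_ne_of_fst]

lemma insertPoleInv_inv_right (hab : a ≠ b) :
    insertPoleInv G (w, a) (w, b) (.inl (G.inv (w, b)).1, (G.inv (w, b)).2) = (.inr 4, 2) := by
  have : G.inv (w, b) ≠ G.inv (w, a) := fun e => hab (by
    have := congrArg G.inv e
    rw [G.inv_inv, G.inv_inv] at this
    exact (congrArg Prod.snd this).symm)
  simp [insertPoleInv, inv_ne_of_fst, this]

lemma insertPoleInv_inl {z : V × Fin 3} (h1 : z ≠ (w, a)) (h2 : z ≠ (w, b))
    (h3 : z ≠ G.inv (w, a)) (h4 : z ≠ G.inv (w, b)) :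
    insertPoleInv G (w, a) (w, b) (.inl z.1, z.2) = (.inl (G.inv z).1, (G.inv z).2) := by
  simp [insertPoleInv, h1, h2, h3, h4]

/-- Every dart of the new graph is a dart of `G` that survives, or one of the darts at the ends of
the four edges leaving the inserted 4-pole, or a dart inside it. -/
lemma insertPoleInv_cases (D : (V ⊕ Fin 8) × Fin 3) :
    (∃ z : V × Fin 3, z ≠ (w, a) ∧ z ≠ (w, b) ∧ z ≠ G.inv (w, a) ∧ z ≠ G.inv (w, b) ∧
      D = (.inl z.1, z.2)) ∨
    D = (.inl w, a) ∨ D = (.inl w, b) ∨ D = (.inl (G.inv (w, a)).1, (G.inv (w, a)).2) ∨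
    D = (.inl (G.inv (w, b)).1, (G.inv (w, b)).2) ∨
    D = (.inr 0, 2) ∨ D = (.inr 2, 2) ∨ D = (.inr 4, 2) ∨ D = (.inr 6, 2) ∨
    D = (.inr 1, 2) ∨ D = (.inr 3, 2) ∨ D = (.inr 5, 2) ∨ D = (.inr 7, 2) ∨
    (∃ n, D = (.inr n, 0)) ∨ ∃ n, D = (.inr n, 1) := by
  obtain ⟨v | n, i⟩ := D
  · by_cases h1 : (v, i) = (w, a)
    · simp_all
    by_cases h2 : (v, i) = (w, b)
    · simp_all
    by_cases h3 : (v, i) = G.inv (w, a)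
    · simp [← h3]
    by_cases h4 : (v, i) = G.inv (w, b)
    · simp [← h4]
    exact .inl ⟨(v, i), h1, h2, h3, h4, rfl⟩
  · fin_cases i
    · simp
    · simp
    · fin_cases n <;> simp

end

/-- The graph with involution `insertPoleInv`. -/
def insertPole [DecidableEq V] (G : DartGraph V) (w : V) (a b : Fin 3) (hab : a ≠ b) :
    DartGraph (V ⊕ Fin 8) where
  inv := insertPoleInv G (w, a) (w, b)
  inv_inv := by
    intro D
    rcases insertPoleInv_cases G w (a := a) (b := b) D with ⟨z, h1, h2, h3, h4, rfl⟩ | rfl | rfl |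
      rfl | rfl | rfl | rfl | rfl | rfl | rfl | rfl | rfl | rfl | ⟨n, rfl⟩ | ⟨n, rfl⟩
    · rw [insertPoleInv_inl G w h1 h2 h3 h4, insertPoleInv_inl G w, G.inv_inv]
      · exact fun e => h3 (G.inv_eq_iff.1 e)
      · exact fun e => h4 (G.inv_eq_iff.1 e)
      · exact fun e => h1 (by rw [← G.inv_inv z, e, G.inv_inv])
      · exact fun e => h2 (by rw [← G.inv_inv z, e, G.inv_inv])
    · rw [insertPoleInv_left]; rfl
    · rw [insertPoleInv_right _ _ hab]; rfl
    · rw [insertPoleInv_inv_left]; rfl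
    · rw [insertPoleInv_inv_right _ _ hab]; rfl
    · exact insertPoleInv_inv_left G w
    · exact insertPoleInv_left G w
    · exact insertPoleInv_inv_right G w hab
    · exact insertPoleInv_right G w hab
    · rfl
    · rfl
    · rfl
    · rfl
    · simp [insertPoleInv]
    · simp [insertPoleInv]
  inv_ne := by
    intro D
    rcases insertPoleInv_cases G w (a := a) (b := b) D with ⟨z, h1, h2, h3, h4, rfl⟩ | rfl | rfl |
      rfl | rfl | rfl | rfl | rfl | rfl | rfl | rfl | rfl | rfl | ⟨n, rfl⟩ | ⟨n, rfl⟩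
    · rw [insertPoleInv_inl G w h1 h2 h3 h4]
      have := G.inv_ne z
      grind
    · rw [insertPoleInv_left]; simp
    · rw [insertPoleInv_right _ _ hab]; simp
    · rw [insertPoleInv_inv_left]; simp
    · rw [insertPoleInv_inv_right _ _ hab]; simp
    all_goals simp [insertPoleInv]
  const := by
    intro D f hf
    have hin : ∀ z : V × Fin 3, z ≠ (w, a) → z ≠ (w, b) → z ≠ G.inv (w, a) → z ≠ G.inv (w, b) →
        (.inl z.1, z.2) ≠ D → (.inl z.1, z.2) ≠ insertPoleInv G (w, a) (w, b) D →
        f (.inl z.1) = f (.inl (G.inv z).1) := by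
      intro z h1 h2 h3 h4 h5 h6
      simpa [insertPoleInv_inl G w h1 h2 h3 h4] using hf (.inl z.1, z.2) h5 h6
    have hcyc : ∀ n : Fin 8, (.inr n, 0) ≠ D → (.inr n, 0) ≠ insertPoleInv G (w, a) (w, b) D →
        f (.inr n) = f (.inr (n + 1)) := fun n h1 h2 => hf (.inr n, 0) h1 h2
    have h0 : (.inr 0, 2) ≠ D → (.inr 0, 2) ≠ insertPoleInv G (w, a) (w, b) D →
        f (.inr 0) = f (.inl (G.inv (w, a)).1) := fun h1 h2 => hf (.inr 0, 2) h1 h2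
    have h2 : (.inr 2, 2) ≠ D → (.inr 2, 2) ≠ insertPoleInv G (w, a) (w, b) D →
        f (.inr 2) = f (.inl w) := fun h1 h2 => hf (.inr 2, 2) h1 h2
    have h4 : (.inr 4, 2) ≠ D → (.inr 4, 2) ≠ insertPoleInv G (w, a) (w, b) D →
        f (.inr 4) = f (.inl (G.inv (w, b)).1) := fun h1 h2 => hf (.inr 4, 2) h1 h2
    have h6 : (.inr 6, 2) ≠ D → (.inr 6, 2) ≠ insertPoleInv G (w, a) (w, b) D →
        f (.inr 6) = f (.inl w) := fun h1 h2 => hf (.inr 6, 2) h1 h2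
    clear hf
    have hr : ∀ n, f (.inr n) = f (.inr 0) := by
      obtain ⟨n₀, hn₀⟩ : ∃ n₀ : Fin 8, ∀ n, n ≠ n₀ → (.inr n, 0) ≠ D ∧
          (.inr n, 0) ≠ insertPoleInv G (w, a) (w, b) D := by
        rcases insertPoleInv_cases G w (a := a) (b := b) D with ⟨z, e1, e2, e3, e4, rfl⟩ | rfl |
          rfl | rfl | rfl | rfl | rfl | rfl | rfl | rfl | rfl | rfl | rfl | ⟨n, rfl⟩ | ⟨n, rfl⟩
        · exact ⟨0, by simp [insertPoleInv_inl G w e1 e2 e3 e4]⟩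
        · exact ⟨0, by simp [insertPoleInv_left]⟩
        · exact ⟨0, by simp [insertPoleInv_right _ _ hab]⟩
        · exact ⟨0, by simp [insertPoleInv_inv_left]⟩
        · exact ⟨0, by simp [insertPoleInv_inv_right _ _ hab]⟩
        · exact ⟨0, by simp [insertPoleInv]⟩
        · exact ⟨0, by simp [insertPoleInv]⟩
        · exact ⟨0, by simp [insertPoleInv]⟩
        · exact ⟨0, by simp [insertPoleInv]⟩
        · exact ⟨0, by simp [insertPoleInv]⟩
        · exact ⟨0, by simp [insertPoleInv]⟩
        · exact ⟨0, by simp [insertPoleInv]⟩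
        · exact ⟨0, by simp [insertPoleInv]⟩
        · exact ⟨n, by simp [insertPoleInv]⟩
        · exact ⟨n - 1, by simp [insertPoleInv]⟩
      exact eq_of_eight_cycle n₀ (fun n => f (.inr n)) fun n hn => hcyc n (hn₀ n hn).1 (hn₀ n hn).2
    -- at most one of the two edges that were cut open, or else an edge of `G`, is exceptional
    have hcases : ((f (.inr 0) = f (.inl (G.inv (w, a)).1) ∧ f (.inr 2) = f (.inl w)) ∧
          (f (.inr 4) = f (.inl (G.inv (w, b)).1) ∧ f (.inr 6) = f (.inl w)) ∧
          ∃ e, ∀ z, z ≠ (w, a) → z ≠ (w, b) → z ≠ G.inv (w, a) → z ≠ G.inv (w, b) →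
            z ≠ e → z ≠ G.inv e → f (.inl z.1) = f (.inl (G.inv z).1)) ∨
        ((f (.inr 0) = f (.inl (G.inv (w, a)).1) ∧ f (.inr 2) = f (.inl w) ∨
          f (.inr 4) = f (.inl (G.inv (w, b)).1) ∧ f (.inr 6) = f (.inl w)) ∧
          ∀ z, z ≠ (w, a) → z ≠ (w, b) → z ≠ G.inv (w, a) → z ≠ G.inv (w, b) →
            f (.inl z.1) = f (.inl (G.inv z).1)) := by
      rcases insertPoleInv_cases G w (a := a) (b := b) D with ⟨z, e1, e2, e3, e4, rfl⟩ | rfl |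
        rfl | rfl | rfl | rfl | rfl | rfl | rfl | rfl | rfl | rfl | rfl | ⟨n, rfl⟩ | ⟨n, rfl⟩
      · simp only [insertPoleInv_inl G w e1 e2 e3 e4] at *
        exact .inl ⟨⟨h0 (by simp) (by simp), h2 (by simp) (by simp)⟩,
          ⟨h4 (by simp) (by simp), h6 (by simp) (by simp)⟩, z, fun z' k1 k2 k3 k4 k5 k6 =>
            hin z' k1 k2 k3 k4 (by clear hin; grind) (by clear hin; grind)⟩
      · simp only [insertPoleInv_left] at *
        exact .inr ⟨.inr ⟨h4 (by simp) (by simp), h6 (by simp) (by simp)⟩,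
          fun z k1 k2 k3 k4 => hin z k1 k2 k3 k4 (by clear hin; grind) (by simp)⟩
      · simp only [insertPoleInv_right _ _ hab] at *
        exact .inr ⟨.inl ⟨h0 (by simp) (by simp), h2 (by simp) (by simp)⟩,
          fun z k1 k2 k3 k4 => hin z k1 k2 k3 k4 (by clear hin; grind) (by simp)⟩
      · simp only [insertPoleInv_inv_left] at *
        exact .inr ⟨.inr ⟨h4 (by simp) (by simp), h6 (by simp) (by simp)⟩,
          fun z k1 k2 k3 k4 => hin z k1 k2 k3 k4 (by clear hin; grind) (by simp)⟩
      · simp only [insertPoleInv_inv_right _ _ hab] at *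
        exact .inr ⟨.inl ⟨h0 (by simp) (by simp), h2 (by simp) (by simp)⟩,
          fun z k1 k2 k3 k4 => hin z k1 k2 k3 k4 (by clear hin; grind) (by simp)⟩
      · simp only [insertPoleInv] at *
        exact .inr ⟨.inr ⟨h4 (by simp) (by simp), h6 (by simp) (by simp)⟩,
          fun z k1 k2 k3 k4 => hin z k1 k2 k3 k4 (by simp) (by clear hin; grind)⟩
      · simp only [insertPoleInv] at *
        exact .inr ⟨.inr ⟨h4 (by simp) (by simp), h6 (by simp) (by simp)⟩,
          fun z k1 k2 k3 k4 => hin z k1 k2 k3 k4 (by simp) (by clear hin; grind)⟩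
      · simp only [insertPoleInv] at *
        exact .inr ⟨.inl ⟨h0 (by simp) (by simp), h2 (by simp) (by simp)⟩,
          fun z k1 k2 k3 k4 => hin z k1 k2 k3 k4 (by simp) (by clear hin; grind)⟩
      · simp only [insertPoleInv] at *
        exact .inr ⟨.inl ⟨h0 (by simp) (by simp), h2 (by simp) (by simp)⟩,
          fun z k1 k2 k3 k4 => hin z k1 k2 k3 k4 (by simp) (by clear hin; grind)⟩
      all_goals
        simp only [insertPoleInv] at *
        exact .inr ⟨.inl ⟨h0 (by simp) (by simp), h2 (by simp) (by simp)⟩,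
          fun z k1 k2 k3 k4 => hin z k1 k2 k3 k4 (by simp) (by simp)⟩
    have hl : (∀ u v, f (.inl u) = f (.inl v)) ∧ f (.inl w) = f (.inr 0) := by
      simp only [hr 2, hr 4, hr 6] at hcases
      rcases hcases with ⟨⟨k0, k2⟩, ⟨k4, k6⟩, e, he⟩ | ⟨k, hk⟩
      · refine ⟨G.const e (fun v => f (.inl v)) fun z e1 e2 => ?_, k2.symm⟩
        by_cases z1 : z = (w, a)
        · subst z1; rw [← k0, ← k2]
        by_cases z2 : z = (w, b)
        · subst z2; rw [← k4, ← k6]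
        by_cases z3 : z = G.inv (w, a)
        · subst z3; rw [G.inv_inv, ← k0, ← k2]
        by_cases z4 : z = G.inv (w, b)
        · subst z4; rw [G.inv_inv, ← k4, ← k6]
        exact he z z1 z2 z3 z4 e1 e2
      · rcases k with ⟨k0, k2⟩ | ⟨k4, k6⟩
        · refine ⟨G.const (w, b) (fun v => f (.inl v)) fun z e1 e2 => ?_, k2.symm⟩
          by_cases z1 : z = (w, a)
          · subst z1; rw [← k0, ← k2]
          by_cases z3 : z = G.inv (w, a)
          · subst z3; rw [G.inv_inv, ← k0, ← k2]
          exact hk z z1 e1 z3 e2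
        · refine ⟨G.const (w, a) (fun v => f (.inl v)) fun z e1 e2 => ?_, k6.symm⟩
          by_cases z2 : z = (w, b)
          · subst z2; rw [← k4, ← k6]
          by_cases z4 : z = G.inv (w, b)
          · subst z4; rw [G.inv_inv, ← k4, ← k6]
          exact hk z e1 z2 e2 z4
    have hall : ∀ u, f u = f (.inr 0) := by
      rintro (v | n)
      · rw [hl.1 v w, hl.2]
      · exact hr n
    intro u v
    rw [hall u, hall v]

set_option synthInstance.maxHeartbeats 400000 in
set_option synthInstance.maxSize 4000 in
/-- A perfect matching that contains the edge from the vertex 2 to `w` uses exactly one of the other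
two edges at the vertices 0 and 4 that leave the 4-pole, which determines it on the 4-pole. -/
lemma insertPole_matching (n : Fin 8 → Fin 3) (hcyc : ∀ i, n i = 0 ↔ n (i + 1) = 1)
    (h15 : n 1 = 2 ↔ n 5 = 2) (h37 : n 3 = 2 ↔ n 7 = 2) (h2 : n 2 = 2) (h6 : n 6 ≠ 2) :
    (n 0 = 2 ∧ n 4 ≠ 2 ∧ ∀ i, n i = ![2, 2, 2, 0, 1, 2, 0, 1] i) ∨
      (n 0 ≠ 2 ∧ n 4 = 2 ∧ ∀ i, n i = ![0, 1, 2, 2, 2, 0, 1, 2] i) := by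
  have key : ∀ n0 n1 : Fin 3, (n0 = 0 ↔ n1 = 1) → ∀ n2 : Fin 3, n2 = 2 → (n1 = 0 ↔ n2 = 1) →
      ∀ n3 : Fin 3, (n2 = 0 ↔ n3 = 1) → ∀ n4 : Fin 3, (n3 = 0 ↔ n4 = 1) →
      ∀ n5 : Fin 3, (n4 = 0 ↔ n5 = 1) → (n1 = 2 ↔ n5 = 2) →
      ∀ n6 : Fin 3, n6 ≠ 2 → (n5 = 0 ↔ n6 = 1) →
      ∀ n7 : Fin 3, (n6 = 0 ↔ n7 = 1) → (n7 = 0 ↔ n0 = 1) → (n3 = 2 ↔ n7 = 2) →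
      (n0 = 2 ∧ n1 = 2 ∧ n3 = 0 ∧ n4 = 1 ∧ n5 = 2 ∧ n6 = 0 ∧ n7 = 1) ∨
      (n0 = 0 ∧ n1 = 1 ∧ n3 = 2 ∧ n4 = 2 ∧ n5 = 0 ∧ n6 = 1 ∧ n7 = 2) := by decide
  rcases key (n 0) (n 1) (hcyc 0) (n 2) h2 (hcyc 1) (n 3) (hcyc 2) (n 4) (hcyc 3) (n 5) (hcyc 4)
      h15 (n 6) h6 (hcyc 5) (n 7) (hcyc 6) (hcyc 7) h37 with ⟨e0, e1, e3, e4, e5, e6, e7⟩ | ⟨e0, e1, e3, e4, e5, e6, e7⟩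
  · refine .inl ⟨e0, by rw [e4]; decide, fun i => ?_⟩
    fin_cases i <;> assumption
  · refine .inr ⟨by rw [e0]; decide, e4, fun i => ?_⟩
    fin_cases i <;> assumption

lemma not_properly_two_colored_five_cycle : ∀ x₀ x₁ x₂ x₃ x₄ : Bool,
    x₀ ≠ x₁ → x₁ ≠ x₂ → x₂ ≠ x₃ → x₃ ≠ x₄ → x₄ ≠ x₀ → False := by
  intro x₀ x₁ x₂ x₃ x₄
  cases x₀ <;> cases x₁ <;> cases x₂ <;> cases x₃ <;> cases x₄ <;> simp

/-- If every edge of every graph lies in both members of some `S₄`-pair, then the frequencies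
1, 1, 0 can be prescribed at every vertex. In an `S₄`-pair of `G.insertPole w a b` whose members
both contain the edge from `w` to the vertex 2, each member leaves the 4-pole by exactly one of the
edges at 0 and 4, and thus induces a perfect matching of `G` that contains `(w, a)` or `(w, b)`
accordingly. If both left by the same edge, a 5-cycle in the 4-pole would avoid both. -/
lemma exists_isS4_one_one_zero
    (h : ∀ (W : Type) [Finite W] (H : DartGraph W) (d : W × Fin 3),
      ∃ m₁ m₂, H.IsS4 m₁ m₂ ∧ m₁ d.1 = d.2 ∧ m₂ d.1 = d.2)
    [Finite V] (G : DartGraph V) (w : V) (a b : Fin 3) (hab : a ≠ b) :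
    ∃ m₁ m₂, G.IsS4 m₁ m₂ ∧ (m₁ w = a ∧ m₂ w = b ∨ m₁ w = b ∧ m₂ w = a) := by
  classical
  obtain ⟨m₁, m₂, ⟨hm₁, hm₂, c, hc⟩, hw₁, hw₂⟩ := h _ (G.insertPole w a b hab) (.inl w, a)
  simp only at hw₁ hw₂
  have hmat : ∀ m, (G.insertPole w a b hab).IsPM m → m (.inl w) = a →
      (m (.inr 0) = 2 ∧ m (.inr 4) ≠ 2 ∧ ∀ i, m (.inr i) = ![2, 2, 2, 0, 1, 2, 0, 1] i) ∨
      (m (.inr 0) ≠ 2 ∧ m (.inr 4) = 2 ∧ ∀ i, m (.inr i) = ![0, 1, 2, 2, 2, 0, 1, 2] i) := by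
    intro m hm hmw
    refine insertPole_matching (fun i => m (.inr i)) (fun i => (hm.iff (.inr i, 0)).symm)
      (hm.iff (.inr 1, 2)).symm (hm.iff (.inr 3, 2)).symm ((hm.iff (.inr 2, 2)).1 hmw) ?_
    exact fun e => hab (hmw.symm.trans (hm (.inr 6, 2) e))
  -- the matching of `G` induced by `m`
  let r : (V ⊕ Fin 8 → Fin 3) → V → Fin 3 := fun m v =>
    if v = w then if m (.inr 0) = 2 then a else b else m (.inl v)
  have hA : ∀ i, (G.inv (w, i)).1 ≠ w := fun i => G.inv_fst_ne (w, i)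
  have hin : ∀ m, (G.insertPole w a b hab).IsPM m → ∀ z : V × Fin 3, z ≠ (w, a) → z ≠ (w, b) →
      z ≠ G.inv (w, a) → z ≠ G.inv (w, b) → m (.inl z.1) = z.2 →
      m (.inl (G.inv z).1) = (G.inv z).2 := by
    intro m hm z h1 h2 h3 h4 h5
    have := hm (.inl z.1, z.2) h5
    rwa [show (G.insertPole w a b hab).inv (.inl z.1, z.2) = _ from
      insertPoleInv_inl G w h1 h2 h3 h4] at this
  have h0 : ∀ m, (G.insertPole w a b hab).IsPM m →
      (m (.inl (G.inv (w, a)).1) = (G.inv (w, a)).2 ↔ m (.inr 0) = 2) :=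
    fun m hm => hm.iff (.inr 0, 2)
  have h4 : ∀ m, (G.insertPole w a b hab).IsPM m →
      (m (.inl (G.inv (w, b)).1) = (G.inv (w, b)).2 ↔ m (.inr 4) = 2) :=
    fun m hm => hm.iff (.inr 4, 2)
  have hr : ∀ m, (G.insertPole w a b hab).IsPM m → m (.inl w) = a → G.IsPM (r m) := by
    intro m hm hmw z hz
    have h04 := hmat m hm hmw
    by_cases z1 : z = G.inv (w, a)
    · subst z1
      rw [G.inv_inv]
      simp only [r, hA, if_false] at hz
      simp [r, (h0 m hm).1 hz]
    by_cases z2 : z = G.inv (w, b)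
    · subst z2
      rw [G.inv_inv]
      simp only [r, hA, if_false] at hz
      have h5 := (h4 m hm).1 hz
      have : m (.inr 0) ≠ 2 := by tauto
      simp [r, this]
    obtain ⟨v, i⟩ := z
    by_cases hv : v = w
    · subst hv
      simp only [r, if_true] at hz
      split_ifs at hz with h5
      · subst hz
        simpa [r, hA] using (h0 m hm).2 h5
      · subst hz
        have : m (.inr 4) = 2 := by tauto
        simpa [r, hA] using (h4 m hm).2 this
    · simp only [r, hv, if_false] at hz
      have h5 := hin m hm (v, i) (by simp [hv]) (by simp [hv]) z1 z2 hz
      have h6 : (G.inv (v, i)).1 ≠ w := by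
        intro e
        rw [e, hmw] at h5
        exact z1 (G.inv_eq_iff.1 (Prod.ext e h5.symm))
      simpa [r, h6] using h5
  have hodd : ¬ (m₁ (.inr 0) = 2 ↔ m₂ (.inr 0) = 2) := by
    have hc' : ∀ i j, m₁ (.inr i) ≠ j → m₂ (.inr i) ≠ j →
        c (.inr i) ≠ c ((G.insertPole w a b hab).inv (.inr i, j)).1 := fun i j => hc (.inr i, j)
    rcases hmat m₁ hm₁ hw₁ with ⟨p1, p2, p3⟩ | ⟨p1, p2, p3⟩ <;>
      rcases hmat m₂ hm₂ hw₂ with ⟨q1, q2, q3⟩ | ⟨q1, q2, q3⟩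
    · have e0 : c (.inr 0) ≠ c (.inr 1) := hc' 0 0 (by simp [p3]) (by simp [q3])
      have e1 : c (.inr 1) ≠ c (.inr 2) := hc' 1 0 (by simp [p3]) (by simp [q3])
      have e2 : c (.inr 2) ≠ c (.inr 3) := hc' 2 0 (by simp [p3]) (by simp [q3])
      have e3 : c (.inr 3) ≠ c (.inr 7) := hc' 3 2 (by simp [p3]) (by simp [q3])
      have e7 : c (.inr 7) ≠ c (.inr 0) := hc' 7 0 (by simp [p3]) (by simp [q3])
      exact (not_properly_two_colored_five_cycle _ _ _ _ _ e0 e1 e2 e3 e7).elim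
    · tauto
    · tauto
    · have e1 : c (.inr 1) ≠ c (.inr 2) := hc' 1 0 (by simp [p3]) (by simp [q3])
      have e2 : c (.inr 2) ≠ c (.inr 3) := hc' 2 0 (by simp [p3]) (by simp [q3])
      have e3 : c (.inr 3) ≠ c (.inr 4) := hc' 3 0 (by simp [p3]) (by simp [q3])
      have e4 : c (.inr 4) ≠ c (.inr 5) := hc' 4 0 (by simp [p3]) (by simp [q3])
      have e5 : c (.inr 5) ≠ c (.inr 1) := hc' 5 2 (by simp [p3]) (by simp [q3])
      exact (not_properly_two_colored_five_cycle _ _ _ _ _ e1 e2 e3 e4 e5).elim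
  have hfreq : r m₁ w = a ∧ r m₂ w = b ∨ r m₁ w = b ∧ r m₂ w = a := by
    simp only [r, if_true]
    split_ifs <;> tauto
  refine ⟨r m₁, r m₂, ⟨hr m₁ hm₁ hw₁, hr m₂ hm₂ hw₂, fun v => c (.inl v), fun z h1 h2 => ?_⟩,
    hfreq⟩
  have z1 : z ≠ (w, a) := by rintro rfl; tauto
  have z2 : z ≠ (w, b) := by rintro rfl; tauto
  have z3 : z ≠ G.inv (w, a) := by
    rintro rfl
    rw [Ne, (hr m₁ hm₁ hw₁).iff (w, a)] at h1
    rw [Ne, (hr m₂ hm₂ hw₂).iff (w, a)] at h2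
    tauto
  have z4 : z ≠ G.inv (w, b) := by
    rintro rfl
    rw [Ne, (hr m₁ hm₁ hw₁).iff (w, b)] at h1
    rw [Ne, (hr m₂ hm₂ hw₂).iff (w, b)] at h2
    tauto
  have hne : ∀ m, m (.inl w) = a → r m z.1 ≠ z.2 → m (.inl z.1) ≠ z.2 := by
    intro m hmw h5 h6
    by_cases hv : z.1 = w
    · exact z1 (Prod.ext hv (by rw [← h6, hv, hmw]))
    · exact h5 (by simpa [r, hv] using h6)
  have := hc (.inl z.1, z.2) (hne m₁ hw₁ h1) (hne m₂ hw₂ h2)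
  rwa [show (G.insertPole w a b hab).inv (.inl z.1, z.2) = _ from
    insertPoleInv_inl G w z1 z2 z3 z4] at this

end DartGraph

/-! ### Reduction to simple graphs -/

namespace DartGraph

variable {V : Type}

/-- No two edges have the same ends. Loops are excluded in any case. -/
def IsSimple (G : DartGraph V) : Prop :=
  ∀ v i j, (G.inv (v, i)).1 = (G.inv (v, j)).1 → i = j

/-- Two parallel edges between `v` and `u`, with darts `(v, i)`, `(v, j)` at `v` and `(u, i')`,
`(u, j')` at `u`, while the third edges at `v` and `u`, with darts `(v, k)` and `(u, k')`, are
distinct. -/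
structure Digon (G : DartGraph V) (v u : V) (i j k i' j' k' : Fin 3) : Prop where
  inv_i : G.inv (v, i) = (u, i')
  inv_j : G.inv (v, j) = (u, j')
  ij : i ≠ j
  ik : i ≠ k
  jk : j ≠ k
  ij' : i' ≠ j'
  ik' : i' ≠ k'
  jk' : j' ≠ k'
  fst_ne : (G.inv (v, k)).1 ≠ u

namespace Digon

variable {G : DartGraph V} {v u : V} {i j k i' j' k' : Fin 3}

lemma ne (h : G.Digon v u i j k i' j' k') : u ≠ v := by
  have := G.inv_fst_ne (v, i)
  rwa [h.inv_i] at this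

lemma inv_i' (h : G.Digon v u i j k i' j' k') : G.inv (u, i') = (v, i) := by
  rw [← h.inv_i, G.inv_inv]

lemma inv_j' (h : G.Digon v u i j k i' j' k') : G.inv (u, j') = (v, j) := by
  rw [← h.inv_j, G.inv_inv]

lemma cases_left (h : G.Digon v u i j k i' j' k') (l : Fin 3) : l = i ∨ l = j ∨ l = k := by
  have := h.ij; have := h.ik; have := h.jk
  lia

lemma cases_right (h : G.Digon v u i j k i' j' k') (l : Fin 3) : l = i' ∨ l = j' ∨ l = k' := by
  have := h.ij'; have := h.ik'; have := h.jk'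
  lia

lemma fst_ne' (h : G.Digon v u i j k i' j' k') : (G.inv (u, k')).1 ≠ v := by
  intro e
  obtain ⟨l, hl⟩ : ∃ l, G.inv (u, k') = (v, l) := ⟨_, Prod.ext e rfl⟩
  have h2 := G.inv_eq_iff.1 hl
  rcases h.cases_left l with rfl | rfl | rfl
  · rw [h.inv_i] at h2; exact h.ik' (by simpa using h2.symm)
  · rw [h.inv_j] at h2; exact h.jk' (by simpa using h2.symm)
  · exact h.fst_ne (by rw [← h2])

/-- A dart whose other end is `v` or `u` either starts there too, or belongs to one of the two edges
leaving the digon. -/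
lemma fst_inv_ne (h : G.Digon v u i j k i' j' k') {z : V × Fin 3} (hv : z.1 ≠ v) (hu : z.1 ≠ u)
    (hk : G.inv z ≠ (v, k)) (hk' : G.inv z ≠ (u, k')) :
    (G.inv z).1 ≠ v ∧ (G.inv z).1 ≠ u := by
  constructor
  · intro e
    obtain ⟨l, hl⟩ : ∃ l, G.inv z = (v, l) := ⟨_, Prod.ext e rfl⟩
    have h2 := G.inv_eq_iff.1 hl
    rcases h.cases_left l with rfl | rfl | rfl
    · rw [h.inv_i] at h2; exact hu (by rw [h2])
    · rw [h.inv_j] at h2; exact hu (by rw [h2])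
    · exact hk hl
  · intro e
    obtain ⟨l, hl⟩ : ∃ l, G.inv z = (u, l) := ⟨_, Prod.ext e rfl⟩
    have h2 := G.inv_eq_iff.1 hl
    rcases h.cases_right l with rfl | rfl | rfl
    · rw [h.inv_i'] at h2; exact hv (by rw [h2])
    · rw [h.inv_j'] at h2; exact hv (by rw [h2])
    · exact hk' hl

lemma mem_left (h : G.Digon v u i j k i' j' k') :
    (G.inv (v, k)).1 ≠ v ∧ (G.inv (v, k)).1 ≠ u := ⟨G.inv_fst_ne _, h.fst_ne⟩

lemma mem_right (h : G.Digon v u i j k i' j' k') :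
    (G.inv (u, k')).1 ≠ v ∧ (G.inv (u, k')).1 ≠ u := ⟨h.fst_ne', G.inv_fst_ne _⟩

end Digon

/-- On the darts not at `v` or `u`, which it preserves if `v` and `u` form a digon, the involution
in which the edges of the darts `(v, k)` and `(u, k')` are merged into one edge. -/
def reduceInv [DecidableEq V] (G : DartGraph V) (v u : V) (k k' : Fin 3) (d : V × Fin 3) :
    V × Fin 3 :=
  if G.inv d = (v, k) then G.inv (u, k') else if G.inv d = (u, k') then G.inv (v, k) else G.inv d

section

variable [DecidableEq V] {G : DartGraph V} {v u : V} {i j k i' j' k' : Fin 3}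

lemma Digon.reduceInv_mem (h : G.Digon v u i j k i' j' k')
    {d : V × Fin 3} (hd : d.1 ≠ v ∧ d.1 ≠ u) :
    (reduceInv G v u k k' d).1 ≠ v ∧ (reduceInv G v u k k' d).1 ≠ u := by
  unfold reduceInv
  split_ifs with h1 h2
  · exact h.mem_right
  · exact h.mem_left
  · exact h.fst_inv_ne hd.1 hd.2 h1 h2

lemma reduceInv_left : reduceInv G v u k k' (G.inv (v, k)) = G.inv (u, k') := by
  simp [reduceInv, G.inv_inv]

lemma Digon.reduceInv_right (h : G.Digon v u i j k i' j' k') :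
    reduceInv G v u k k' (G.inv (u, k')) = G.inv (v, k) := by
  simp [reduceInv, G.inv_inv, h.ne]

lemma reduceInv_of_mem {d : V × Fin 3} (hd : (G.inv d).1 ≠ v ∧ (G.inv d).1 ≠ u) :
    reduceInv G v u k k' d = G.inv d := by
  unfold reduceInv
  rw [if_neg (fun e => hd.1 (by rw [e])), if_neg (fun e => hd.2 (by rw [e]))]

lemma Digon.dart_cases (h : G.Digon v u i j k i' j' k')
    {d : V × Fin 3} (hd : d.1 ≠ v ∧ d.1 ≠ u) :
    d = G.inv (v, k) ∨ d = G.inv (u, k') ∨ (G.inv d).1 ≠ v ∧ (G.inv d).1 ≠ u := by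
  by_cases h1 : G.inv d = (v, k)
  · exact .inl (G.inv_eq_iff.1 h1)
  by_cases h2 : G.inv d = (u, k')
  · exact .inr (.inl (G.inv_eq_iff.1 h2))
  exact .inr (.inr (h.fst_inv_ne hd.1 hd.2 h1 h2))

/-- The graph obtained from `G` by deleting the two vertices of a digon and merging the two edges
that leave it. -/
def Digon.reduce (h : G.Digon v u i j k i' j' k') :
    DartGraph {x : V // x ≠ v ∧ x ≠ u} where
  inv d := (⟨(reduceInv G v u k k' (d.1, d.2)).1, h.reduceInv_mem d.1.2⟩,
    (reduceInv G v u k k' (d.1, d.2)).2)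
  inv_inv := by
    rintro ⟨⟨x, hx⟩, l⟩
    have : reduceInv G v u k k' (reduceInv G v u k k' (x, l)) = (x, l) := by
      rcases h.dart_cases (d := (x, l)) hx with e | e | e
      · rw [e, reduceInv_left, h.reduceInv_right]
      · rw [e, h.reduceInv_right, reduceInv_left]
      · rw [reduceInv_of_mem e, reduceInv_of_mem (by rwa [G.inv_inv]), G.inv_inv]
    simp [this]
  inv_ne := by
    rintro ⟨⟨x, hx⟩, l⟩ e
    have : reduceInv G v u k k' (x, l) = (x, l) := by
      simp only [Prod.mk.injEq, Subtype.mk.injEq] at e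
      exact Prod.ext e.1 e.2
    have hne : G.inv (v, k) ≠ G.inv (u, k') := fun e => h.ne (by
      have := congrArg G.inv e
      rw [G.inv_inv, G.inv_inv] at this
      exact (congrArg Prod.fst this).symm)
    rcases h.dart_cases (d := (x, l)) hx with e | e | e
    · rw [e, reduceInv_left] at this; exact hne this.symm
    · rw [e, h.reduceInv_right] at this; exact hne this
    · rw [reduceInv_of_mem e] at this; exact G.inv_ne _ this
  const := by
    rintro ⟨⟨x, hx⟩, l⟩ f hf
    -- extend the colouring to the digon by the colour of the outer neighbour of `v`
    let F : V → Bool := fun y => if hy : y ≠ v ∧ y ≠ u then f ⟨y, hy⟩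
      else f ⟨(G.inv (v, k)).1, h.mem_left⟩
    have hF : ∀ y (hy : y ≠ v ∧ y ≠ u), F y = f ⟨y, hy⟩ := fun y hy => dif_pos hy
    have hFv : F v = F (G.inv (v, k)).1 := by
      rw [hF _ h.mem_left]; exact dif_neg (by simp)
    have hFu : F u = F (G.inv (v, k)).1 := by
      rw [hF _ h.mem_left]; exact dif_neg (by simp)
    have hred : ∀ d : V × Fin 3, d.1 ≠ v ∧ d.1 ≠ u → d ≠ (x, l) →
        d ≠ reduceInv G v u k k' (x, l) → F d.1 = F (reduceInv G v u k k' d).1 := by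
      intro d hd h1 h2
      rw [hF _ hd, hF _ (h.reduceInv_mem hd)]
      refine hf (⟨d.1, hd⟩, d.2) (fun e => h1 ?_) (fun e => h2 ?_)
      · simp only [Prod.mk.injEq, Subtype.mk.injEq] at e
        exact Prod.ext e.1 e.2
      · simp only [Prod.mk.injEq, Subtype.mk.injEq] at e
        exact Prod.ext e.1 e.2
    have hconst : ∀ y z, F y = F z := by
      -- the edge of `(v, k)` and the digon are never exceptional for `F`
      have hbase : ∀ e : V × Fin 3,
          (∀ d : V × Fin 3, d.1 ≠ v ∧ d.1 ≠ u → (G.inv d).1 ≠ v ∧ (G.inv d).1 ≠ u →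
            d ≠ e → d ≠ G.inv e → F d.1 = F (G.inv d).1) →
          (G.inv (u, k') ≠ e → F (G.inv (v, k)).1 = F (G.inv (u, k')).1) →
          ∀ y z, F y = F z := by
        intro e he he'
        refine G.const e F ?_
        rintro ⟨y, n⟩ h1 h2
        by_cases hyv : y = v
        · subst hyv
          rcases h.cases_left n with rfl | rfl | rfl
          · rw [h.inv_i, hFv, hFu]
          · rw [h.inv_j, hFv, hFu]
          · exact hFv
        by_cases hyu : y = u
        · subst hyu
          rcases h.cases_right n with rfl | rfl | rfl
          · rw [h.inv_i', hFv, hFu]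
          · rw [h.inv_j', hFv, hFu]
          · rw [hFu]; exact he' (fun e' => h2 (by rw [← e', G.inv_inv]))
        rcases h.dart_cases (d := (y, n)) ⟨hyv, hyu⟩ with e' | e' | e'
        · rw [e', G.inv_inv, hFv]
        · rw [e', G.inv_inv, hFu, he' (fun e'' => h1 (by rw [e', e''])) ]
        · exact he _ ⟨hyv, hyu⟩ e' h1 h2
      rcases h.dart_cases (d := (x, l)) hx with e | e | e
      · refine hbase (G.inv (u, k')) (fun d h1 h2 h3 _ => ?_) (fun h' => absurd rfl h')
        rw [hred d h1 ?_ ?_, reduceInv_of_mem h2]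
        · rw [e]; rintro rfl; rw [G.inv_inv] at h2; exact h2.1 rfl
        · rw [e, reduceInv_left]; exact h3
      · refine hbase (G.inv (u, k')) (fun d h1 h2 h3 _ => ?_) (fun h' => absurd rfl h')
        rw [hred d h1 ?_ ?_, reduceInv_of_mem h2]
        · rw [e]; exact h3
        · rw [e, h.reduceInv_right]; rintro rfl; rw [G.inv_inv] at h2; exact h2.1 rfl
      · refine hbase (x, l) (fun d h1 h2 h3 h4 => ?_) (fun _ => ?_)
        · rw [hred d h1 h3 (by rwa [reduceInv_of_mem e]), reduceInv_of_mem h2]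
        · rw [hred _ h.mem_left ?_ ?_, reduceInv_left]
          · intro e'; rw [← e', G.inv_inv] at e; exact e.1 rfl
          · rw [reduceInv_of_mem e]; intro e'
            have := congrArg G.inv e'
            rw [G.inv_inv, G.inv_inv] at this
            exact hx.1 (congrArg Prod.fst this).symm
    intro y z
    rw [← hF y y.2, ← hF z z.2, hconst]

end

/-- An `S₄`-pair of the reduced graph extends to the digon. A member that contains the merged edge
contains both edges leaving the digon; otherwise it contains one of the two parallel edges, a
different one for each member. -/
lemma Digon.exists_isS4 [DecidableEq V] {G : DartGraph V} {v u : V} {i j k i' j' k' : Fin 3}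
    (h : G.Digon v u i j k i' j' k') {m₁ m₂ : {x : V // x ≠ v ∧ x ≠ u} → Fin 3}
    (hm : h.reduce.IsS4 m₁ m₂) : ∃ m₁ m₂, G.IsS4 m₁ m₂ := by
  obtain ⟨hm₁, hm₂, c, hc⟩ := hm
  let p : {x : V // x ≠ v ∧ x ≠ u} := ⟨(G.inv (v, k)).1, h.mem_left⟩
  let q : {x : V // x ≠ v ∧ x ≠ u} := ⟨(G.inv (u, k')).1, h.mem_right⟩
  have hred : ∀ x (hx : x ≠ v ∧ x ≠ u) (n : Fin 3) (hy : (G.inv (x, n)).1 ≠ v ∧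
      (G.inv (x, n)).1 ≠ u), h.reduce.inv (⟨x, hx⟩, n) = (⟨_, hy⟩, (G.inv (x, n)).2) := by
    intro x hx n hy
    simp [Digon.reduce, reduceInv_of_mem hy]
  have hpq : h.reduce.inv (p, (G.inv (v, k)).2) = (q, (G.inv (u, k')).2) := by
    simp [Digon.reduce, p, q, reduceInv_left]
  -- the extension of a matching, using the darts `(v, l)` and `(u, l')` if it misses the new edge
  let E : ({x : V // x ≠ v ∧ x ≠ u} → Fin 3) → Fin 3 → Fin 3 → V → Fin 3 := fun m l l' x =>
    if hx : x ≠ v ∧ x ≠ u then m ⟨x, hx⟩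
    else if m p = (G.inv (v, k)).2 then (if x = v then k else k')
    else if x = v then l else l'
  have hE : ∀ m l l' x (hx : x ≠ v ∧ x ≠ u), E m l l' x = m ⟨x, hx⟩ :=
    fun m l l' x hx => dif_pos hx
  have hEv : ∀ m l l', E m l l' v = if m p = (G.inv (v, k)).2 then k else l := by
    intro m l l'
    simp [E]
  have hEu : ∀ m l l', E m l l' u = if m p = (G.inv (v, k)).2 then k' else l' := by
    intro m l l'
    simp [E, h.ne]
  have hpq' : ∀ m, h.reduce.IsPM m →
      (m q = (G.inv (u, k')).2 ↔ m p = (G.inv (v, k)).2) := by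
    intro m hm
    have := hm.iff (p, (G.inv (v, k)).2)
    rwa [hpq] at this
  have hPM : ∀ m l l', h.reduce.IsPM m → G.inv (v, l) = (u, l') → l ≠ k → l' ≠ k' →
      G.IsPM (E m l l') := by
    rintro m l l' hm hl hlk hlk' ⟨x, n⟩ hx
    simp only at hx
    by_cases hxv : x = v
    · subst hxv
      rw [hEv] at hx
      split_ifs at hx with h1
      · subst hx
        rw [hE _ _ _ _ h.mem_left]; exact h1
      · subst hx
        rw [hl, hEu, if_neg h1]
    by_cases hxu : x = u
    · subst hxu
      rw [hEu] at hx
      split_ifs at hx with h1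
      · subst hx
        rw [hE _ _ _ _ h.mem_right]; exact (hpq' m hm).2 h1
      · subst hx
        rw [← hl, G.inv_inv, hEv, if_neg h1]
    rw [hE _ _ _ _ ⟨hxv, hxu⟩] at hx
    rcases h.dart_cases (d := (x, n)) ⟨hxv, hxu⟩ with e | e | e
    · rw [e, G.inv_inv, hEv, if_pos]
      rw [show p = ⟨x, hxv, hxu⟩ from Subtype.ext (congrArg Prod.fst e).symm,
        ← congrArg Prod.snd e]
      exact hx
    · rw [e, G.inv_inv, hEu, if_pos]
      rw [← hpq' m hm]
      rw [show q = ⟨x, hxv, hxu⟩ from Subtype.ext (congrArg Prod.fst e).symm,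
        ← congrArg Prod.snd e]
      exact hx
    · rw [hE _ _ _ _ e]
      have := hm (⟨x, hxv, hxu⟩, n) hx
      rwa [hred x ⟨hxv, hxu⟩ n e] at this
  refine ⟨E m₁ i i', E m₂ j j', hPM m₁ i i' hm₁ h.inv_i h.ik h.ik',
    hPM m₂ j j' hm₂ h.inv_j h.jk h.jk', ?_⟩
  -- if both members miss the merged edge, then they cover both parallel edges; otherwise a parallel
  -- edge may be left and the digon is coloured properly
  let C : V → Bool := fun x => if hx : x ≠ v ∧ x ≠ u then c ⟨x, hx⟩
    else if m₁ p ≠ (G.inv (v, k)).2 ∧ m₂ p ≠ (G.inv (v, k)).2 then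
      (if x = v then !c p else !c q)
    else decide (x = v)
  have hC : ∀ x (hx : x ≠ v ∧ x ≠ u), C x = c ⟨x, hx⟩ := fun x hx => dif_pos hx
  have hCv : C v = if m₁ p ≠ (G.inv (v, k)).2 ∧ m₂ p ≠ (G.inv (v, k)).2 then !c p else true := by
    simp [C]
  have hCu : C u = if m₁ p ≠ (G.inv (v, k)).2 ∧ m₂ p ≠ (G.inv (v, k)).2 then !c q else false := by
    simp [C, h.ne]
  have hleft : ∀ n, E m₁ i i' v ≠ n → E m₂ j j' v ≠ n → C v ≠ C (G.inv (v, n)).1 := by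
    intro n h1 h2
    rw [hEv] at h1 h2
    revert h1 h2
    rcases h.cases_left n with e | e | e
    · subst n
      rw [h.inv_i, hCv, hCu]
      by_cases h5 : m₁ p = (G.inv (v, k)).2 <;> by_cases h6 : m₂ p = (G.inv (v, k)).2 <;>
        simp [h5, h6]
    · subst n
      rw [h.inv_j, hCv, hCu]
      by_cases h5 : m₁ p = (G.inv (v, k)).2 <;> by_cases h6 : m₂ p = (G.inv (v, k)).2 <;>
        simp [h5, h6]
    · subst n
      rw [hCv, hC _ h.mem_left]
      change _ → _ → _ ≠ c p
      by_cases h5 : m₁ p = (G.inv (v, k)).2 <;> by_cases h6 : m₂ p = (G.inv (v, k)).2 <;>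
        simp [h5, h6]
  have hright : ∀ n, E m₁ i i' u ≠ n → E m₂ j j' u ≠ n → C u ≠ C (G.inv (u, n)).1 := by
    intro n h1 h2
    rw [hEu] at h1 h2
    revert h1 h2
    rcases h.cases_right n with e | e | e
    · subst n
      rw [h.inv_i', hCv, hCu]
      by_cases h5 : m₁ p = (G.inv (v, k)).2 <;> by_cases h6 : m₂ p = (G.inv (v, k)).2 <;>
        simp [h5, h6]
    · subst n
      rw [h.inv_j', hCv, hCu]
      by_cases h5 : m₁ p = (G.inv (v, k)).2 <;> by_cases h6 : m₂ p = (G.inv (v, k)).2 <;>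
        simp [h5, h6]
    · subst n
      rw [hCu, hC _ h.mem_right]
      change _ → _ → _ ≠ c q
      by_cases h5 : m₁ p = (G.inv (v, k)).2 <;> by_cases h6 : m₂ p = (G.inv (v, k)).2 <;>
        simp [h5, h6]
  refine ⟨C, ?_⟩
  rintro ⟨x, n⟩ h1 h2
  by_cases hxv : x = v
  · subst hxv; exact hleft n h1 h2
  by_cases hxu : x = u
  · subst hxu; exact hright n h1 h2
  have h3 := (hPM m₁ i i' hm₁ h.inv_i h.ik h.ik').iff (x, n)
  have h4 := (hPM m₂ j j' hm₂ h.inv_j h.jk h.jk').iff (x, n)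
  rcases h.dart_cases (d := (x, n)) ⟨hxv, hxu⟩ with e | e | e
  · rw [e, G.inv_inv] at h3 h4 ⊢
    rw [← e] at h3 h4
    exact (hleft k (mt h3.1 h1) (mt h4.1 h2)).symm
  · rw [e, G.inv_inv] at h3 h4 ⊢
    rw [← e] at h3 h4
    exact (hright k' (mt h3.1 h1) (mt h4.1 h2)).symm
  · rw [hE _ _ _ _ ⟨hxv, hxu⟩] at h1 h2
    have := hc (⟨x, hxv, hxu⟩, n) h1 h2
    rw [hred x ⟨hxv, hxu⟩ n e] at this
    rwa [hC _ ⟨hxv, hxu⟩, hC _ e]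

/-- The graph with two vertices and three parallel edges has an `S₄`-pair. -/
lemma exists_isS4_of_theta {G : DartGraph V} {v u : V} (h : ∀ l, (G.inv (v, l)).1 = u) :
    ∃ m₁ m₂, G.IsS4 m₁ m₂ := by
  classical
  have huv : u ≠ v := by rw [← h 0]; exact G.inv_fst_ne _
  -- the other ends of the three darts at `v` are three darts at `u`, hence all of them
  have hu : ∀ l, (G.inv (u, l)).1 = v := by
    have hsurj : Function.Surjective fun l : Fin 3 => (G.inv (v, l)).2 := by
      refine Finite.surjective_of_injective fun l l' e => ?_
      have h1 : G.inv (v, l) = G.inv (v, l') := Prod.ext ((h l).trans (h l').symm) e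
      have h2 := congrArg G.inv h1
      rw [G.inv_inv, G.inv_inv] at h2
      exact congrArg Prod.snd h2
    intro l
    obtain ⟨l', hl'⟩ := hsurj l
    have h1 : G.inv (v, l') = (u, l) := Prod.ext (h l') hl'
    rw [← h1, G.inv_inv]
  have hV : ∀ x, x = v ∨ x = u := by
    intro x
    have := G.const (v, 0) (fun x => decide (x = v ∨ x = u)) (by
      rintro ⟨y, n⟩ - -
      by_cases hy : y = v
      · subst hy; simp [h]
      by_cases hy' : y = u
      · subst hy'; simp [hu]
      have h1 : (G.inv (y, n)).1 ≠ v := by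
        intro e
        have h2 : G.inv (y, n) = (v, (G.inv (y, n)).2) := Prod.ext e rfl
        have h3 := congrArg Prod.fst (G.inv_eq_iff.1 h2)
        rw [h] at h3
        exact hy' h3
      have h2 : (G.inv (y, n)).1 ≠ u := by
        intro e
        have h2 : G.inv (y, n) = (u, (G.inv (y, n)).2) := Prod.ext e rfl
        have h3 := congrArg Prod.fst (G.inv_eq_iff.1 h2)
        rw [hu] at h3
        exact hy h3
      simp [hy, hy', h1, h2]) x v
    simpa using this
  have hPM : G.IsPM fun x => if x = v then 0 else (G.inv (v, 0)).2 := by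
    rintro ⟨x, n⟩ hx
    rcases hV x with rfl | rfl
    · simp only [if_true] at hx
      subst hx
      simp [h, huv]
    · simp only [huv, if_false] at hx
      have h1 : (x, n) = G.inv (v, 0) := Prod.ext (h 0).symm hx.symm
      rw [h1, G.inv_inv]; simp
  refine ⟨_, _, hPM, hPM, fun x => decide (x = v), ?_⟩
  rintro ⟨x, n⟩ - -
  rcases hV x with rfl | rfl
  · simp [h, huv]
  · simp [hu, huv]

/-- It suffices to find `S₄`-pairs in simple graphs: remove digons one by one. -/
theorem exists_isS4_of_isSimple
    (hS : ∀ (W : Type) [Finite W] [Nonempty W] (H : DartGraph W), H.IsSimple →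
      ∃ m₁ m₂, H.IsS4 m₁ m₂)
    [Finite V] [Nonempty V] (G : DartGraph V) : ∃ m₁ m₂, G.IsS4 m₁ m₂ := by
  classical
  induction hn : Nat.card V using Nat.strong_induction_on generalizing V with
  | _ n ih =>
    subst hn
    by_cases hG : G.IsSimple
    · exact hS V G hG
    obtain ⟨v, i, j, hij, hne⟩ : ∃ v i j, (G.inv (v, i)).1 = (G.inv (v, j)).1 ∧ i ≠ j := by
      simpa [IsSimple] using hG
    have hthird : ∀ i j : Fin 3, i ≠ j →
        ∃ k, i ≠ k ∧ j ≠ k ∧ ∀ l, l = i ∨ l = j ∨ l = k := by decide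
    obtain ⟨k, hik, hjk, hk⟩ := hthird i j hne
    by_cases hvk : (G.inv (v, k)).1 = (G.inv (v, i)).1
    · refine exists_isS4_of_theta (v := v) (u := (G.inv (v, i)).1) fun l => ?_
      rcases hk l with rfl | rfl | rfl
      exacts [rfl, hij.symm, hvk]
    have hne' : (G.inv (v, i)).2 ≠ (G.inv (v, j)).2 := by
      intro e
      have h1 := congrArg G.inv (Prod.ext hij e)
      rw [G.inv_inv, G.inv_inv] at h1
      exact hne (congrArg Prod.snd h1)
    obtain ⟨k', hik', hjk', -⟩ := hthird _ _ hne'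
    have hD : G.Digon v (G.inv (v, i)).1 i j k (G.inv (v, i)).2 (G.inv (v, j)).2 k' :=
      ⟨rfl, Prod.ext hij.symm rfl, hne, hik, hjk, hne', hik', hjk', hvk⟩
    have : Nonempty {x : V // x ≠ v ∧ x ≠ (G.inv (v, i)).1} := ⟨⟨_, hD.mem_left⟩⟩
    have hcard : Nat.card {x : V // x ≠ v ∧ x ≠ (G.inv (v, i)).1} < Nat.card V :=
      Finite.card_subtype_lt (x := v) (by simp)
    obtain ⟨m₁, m₂, hm⟩ := ih _ hcard hD.reduce rfl
    exact hD.exists_isS4 hm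

end DartGraph

/-! ### From darts to multigraphs and back -/

namespace DartGraph

variable {V : Type}

/-- The edge of a dart. -/
def edge (G : DartGraph V) (d : V × Fin 3) : Sym2 (V × Fin 3) := s(d, G.inv d)

lemma edge_inv (G : DartGraph V) (d : V × Fin 3) : G.edge (G.inv d) = G.edge d := by
  simp [edge, G.inv_inv, Sym2.eq_swap]

lemma edge_eq_iff (G : DartGraph V) {d d' : V × Fin 3} :
    G.edge d' = G.edge d ↔ d' = d ∨ d' = G.inv d := by
  constructor
  · intro h
    rcases Sym2.eq_iff.1 h with h | h
    · exact .inl h.1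
    · exact .inr h.1
  · rintro (rfl | rfl)
    · rfl
    · exact G.edge_inv d

/-- The multigraph presented by `G`. -/
def toGraph (G : DartGraph V) : Graph V (Sym2 (V × Fin 3)) where
  vertexSet := Set.univ
  IsLink e x y := ∃ d, e = G.edge d ∧ x = d.1 ∧ y = (G.inv d).1
  isLink_symm := by
    rintro e -
    constructor
    rintro x y ⟨d, rfl, rfl, rfl⟩
    exact ⟨G.inv d, (G.edge_inv d).symm, rfl, by rw [G.inv_inv]⟩
  eq_or_eq_of_isLink_of_isLink := by
    rintro e x y v w ⟨d, rfl, rfl, rfl⟩ ⟨d', h, rfl, rfl⟩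
    rcases G.edge_eq_iff.1 h with rfl | rfl
    · exact .inl rfl
    · exact .inr rfl
  left_mem_of_isLink := by simp

lemma toGraph_isLink (G : DartGraph V) (d : V × Fin 3) :
    G.toGraph.IsLink (G.edge d) d.1 (G.inv d).1 := ⟨d, rfl, rfl, rfl⟩

lemma edge_injective (G : DartGraph V) (x : V) :
    Function.Injective fun i : Fin 3 => G.edge (x, i) := by
  intro i j h
  rcases G.edge_eq_iff.1 h with h | h
  · simpa using h
  · exact absurd (congrArg Prod.fst h).symm (G.inv_fst_ne _)

lemma incidenceSet_toGraph (G : DartGraph V) (x : V) :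
    G.toGraph.incidenceSet x = Set.range fun i : Fin 3 => G.edge (x, i) := by
  ext e
  constructor
  · rintro ⟨y, ⟨z, i⟩, rfl, rfl, rfl⟩
    exact ⟨i, rfl⟩
  · rintro ⟨i, rfl⟩
    exact ⟨_, G.toGraph_isLink (x, i)⟩

lemma not_isLoopAt_toGraph (G : DartGraph V) (e : Sym2 (V × Fin 3)) (x : V) :
    ¬ G.toGraph.IsLoopAt e x := by
  rintro ⟨d, rfl, rfl, h⟩
  exact G.inv_fst_ne d h.symm

/-- Deleting one edge leaves the graph connected: colour each vertex by whether it can be reached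
from `x`. -/
lemma reachable_toGraph_deleteEdges (G : DartGraph V) (d : V × Fin 3) (x y : V) :
    (G.toGraph.deleteEdges {G.edge d}).Reachable x y := by
  classical
  have h := G.const d (fun z => decide ((G.toGraph.deleteEdges {G.edge d}).Reachable x z)) (by
    intro d' h1 h2
    have hl : (G.toGraph.deleteEdges {G.edge d}).IsLink (G.edge d') d'.1 (G.inv d').1 := by
      rw [Graph.deleteEdges_isLink]
      refine ⟨G.toGraph_isLink d', fun e => ?_⟩
      rcases G.edge_eq_iff.1 e with e | e
      exacts [h1 e, h2 e]
    have : (G.toGraph.deleteEdges {G.edge d}).Reachable x d'.1 ↔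
        (G.toGraph.deleteEdges {G.edge d}).Reachable x (G.inv d').1 :=
      ⟨fun h => h.tail hl.adj, fun h => h.tail hl.symm.adj⟩
    simp only [this]) x y
  have hx : (G.toGraph.deleteEdges {G.edge d}).Reachable x x := Relation.ReflTransGen.refl
  simpa [hx] using h

lemma isBridgelessCubic_toGraph [Finite V] [Nonempty V] (G : DartGraph V) :
    G.toGraph.IsBridgelessCubic where
  finite_vertexSet := Set.toFinite _
  finite_edgeSet := Set.toFinite _
  connected := by
    refine ⟨Set.univ_nonempty, fun x _ y _ => ?_⟩
    refine Relation.ReflTransGen.mono ?_ x y (G.reachable_toGraph_deleteEdges (x, 0) x y)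
    rintro u v ⟨e, he⟩
    rw [Graph.deleteEdges_isLink] at he
    exact ⟨e, he.1⟩
  bridgeless := by
    rintro e - ⟨x, y, ⟨d, rfl, rfl, rfl⟩, h⟩
    exact h (G.reachable_toGraph_deleteEdges d _ _)
  cubic := by
    intro x _
    have h1 : G.toGraph.loopSet x = ∅ := by
      ext e; simp [G.not_isLoopAt_toGraph]
    rw [Graph.degree, h1, G.incidenceSet_toGraph, Set.ncard_empty, add_zero, ← Set.image_univ,
      Set.ncard_image_of_injective _ (G.edge_injective x), Set.ncard_univ]
    simp

lemma simple_toGraph {G : DartGraph V} (hG : G.IsSimple) : G.toGraph.Simple where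
  not_isLoopAt := G.not_isLoopAt_toGraph
  eq_of_isLink := by
    rintro e f x y ⟨⟨z, i⟩, rfl, rfl, rfl⟩ ⟨⟨z', j⟩, rfl, h1, h2⟩
    simp only at h1
    subst h1
    rw [hG _ _ _ h2]

lemma exists_isPM_of_isPerfectMatching {G : DartGraph V} {M : Set (Sym2 (V × Fin 3))}
    (hM : G.toGraph.IsPerfectMatching M) :
    ∃ m, G.IsPM m ∧ ∀ d : V × Fin 3, m d.1 = d.2 ↔ G.edge d ∈ M := by
  have huniq : ∀ x, ∃ i, ∀ j, i = j ↔ G.edge (x, j) ∈ M := by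
    intro x
    have h1 : (G.toGraph.restrict M).loopSet x = ∅ := by
      ext e; simp [G.not_isLoopAt_toGraph]
    have h2 := hM.2 x trivial
    rw [Graph.degree, h1, Set.ncard_empty, add_zero, Set.ncard_eq_one] at h2
    obtain ⟨e, he⟩ := h2
    have hmem : ∀ e', e' = e ↔ e' ∈ G.toGraph.incidenceSet x ∧ e' ∈ M := by
      intro e'
      rw [← Set.mem_singleton_iff, ← he]
      simp
    rw [G.incidenceSet_toGraph] at hmem
    obtain ⟨⟨i, hi⟩, -⟩ := (hmem e).1 rfl
    refine ⟨i, fun j => ?_⟩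
    have h3 := hmem (G.edge (x, j))
    rw [← hi, (G.edge_injective x).eq_iff] at h3
    rw [eq_comm, h3]
    exact and_iff_right ⟨j, rfl⟩
  choose m hm using huniq
  have hm' : ∀ d : V × Fin 3, m d.1 = d.2 ↔ G.edge d ∈ M := fun d => hm d.1 d.2
  exact ⟨m, fun d hd => by rw [hm', G.edge_inv, ← hm']; exact hd, hm'⟩

lemma exists_isS4_of_isS4Pair {G : DartGraph V} {M₁ M₂ : Set (Sym2 (V × Fin 3))}
    (h : G.toGraph.IsS4Pair M₁ M₂) : ∃ m₁ m₂, G.IsS4 m₁ m₂ := by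
  obtain ⟨m₁, h₁, h₁'⟩ := exists_isPM_of_isPerfectMatching h.left
  obtain ⟨m₂, h₂, h₂'⟩ := exists_isPM_of_isPerfectMatching h.right
  obtain ⟨c, hc⟩ := h.bipartite
  refine ⟨m₁, m₂, h₁, h₂, c, fun d hd₁ hd₂ => hc (G.edge d) _ _ ?_⟩
  rw [Graph.deleteEdges_isLink]
  refine ⟨G.toGraph_isLink d, ?_⟩
  rintro (e | e)
  · exact hd₁ ((h₁' d).2 e)
  · exact hd₂ ((h₂' d).2 e)

/-- The `S₄`-Conjecture for simple graphs yields `S₄`-pairs in all bridgeless cubic multigraphs. -/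
lemma exists_isS4_of_S4Conjecture (h : Graph.S4Conjecture) (W : Type) [Finite W] [Nonempty W]
    (H : DartGraph W) : ∃ m₁ m₂, H.IsS4 m₁ m₂ := by
  refine exists_isS4_of_isSimple (fun W _ _ H hH => ?_) H
  obtain ⟨M₁, M₂, hM⟩ := h _ _ H.toGraph (simple_toGraph hH) H.isBridgelessCubic_toGraph
  exact exists_isS4_of_isS4Pair hM

end DartGraph

namespace Graph

variable {α β : Type} {G : Graph α β}

/-- A loop at a vertex of a cubic graph leaves room for one further edge, which is a bridge. -/
lemma IsBridgelessCubic.not_isLoopAt (hG : G.IsBridgelessCubic) (e : β) (x : α) :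
    ¬ G.IsLoopAt e x := by
  intro he
  have hfin : (G.incidenceSet x).Finite :=
    hG.finite_edgeSet.subset (G.incidenceSet_subset_edgeSet x)
  have hsub : G.loopSet x ⊆ G.incidenceSet x := G.loopSet_subset_incidenceSet x
  have hdeg : (G.incidenceSet x).ncard + (G.loopSet x).ncard = 3 := hG.cubic x he.vertex_mem
  have hpos : 0 < (G.loopSet x).ncard := (Set.ncard_pos (hfin.subset hsub)).2 ⟨e, he⟩
  have hle := Set.ncard_le_ncard hsub hfin
  -- one loop and one further edge
  have hdiff : (G.incidenceSet x \ G.loopSet x).ncard = 1 := by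
    rw [Set.ncard_sdiff hsub (hfin.subset hsub)]
    lia
  obtain ⟨f, hf⟩ := Set.ncard_eq_one.1 hdiff
  have hfmem : f ∈ G.incidenceSet x \ G.loopSet x := by rw [hf]; rfl
  obtain ⟨⟨y, hxy⟩, hnl⟩ := hfmem
  have hyx : y ≠ x := by rintro rfl; exact hnl hxy
  refine hG.bridgeless f hxy.edge_mem ⟨x, y, hxy, fun hr => hyx ?_⟩
  have hstep : ∀ z, (G.deleteEdges {f}).Reachable x z → z = x := by
    intro z hz
    induction hz with
    | refl => rfl
    | tail _ hadj ih =>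
      subst ih
      obtain ⟨g, hg⟩ := hadj
      rw [deleteEdges_isLink] at hg
      by_contra hne
      have : g ∈ ({f} : Set β) := by
        rw [← hf]
        exact ⟨⟨_, hg.1⟩, fun hloop => hne (hg.1.right_unique hloop)⟩
      exact hg.2 this
  exact hstep y hr

lemma IsBridgelessCubic.ncard_incidenceSet (hG : G.IsBridgelessCubic) {x : α}
    (hx : x ∈ G.vertexSet) : (G.incidenceSet x).ncard = 3 := by
  have h1 : G.loopSet x = ∅ := by
    ext e; simp [hG.not_isLoopAt]
  have := hG.cubic x hx
  rwa [degree, h1, Set.ncard_empty, add_zero] at this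

/-- A labelling of the darts of a multigraph by a dart presentation: `lab v i` is the edge of the
dart `(v, i)`. -/
structure DartLabelling (G : Graph α β) (D : DartGraph G.vertexSet) where
  /-- The edge of the dart `(v, i)`. -/
  lab : G.vertexSet × Fin 3 → β
  inj : ∀ v i j, lab (v, i) = lab (v, j) → i = j
  range : ∀ v : G.vertexSet, ∀ e, e ∈ G.incidenceSet v ↔ ∃ i, lab (v, i) = e
  lab_inv : ∀ d, lab (D.inv d) = lab d
  isLink : ∀ d, G.IsLink (lab d) d.1 (D.inv d).1

lemma IsBridgelessCubic.exists_dartLabelling (hG : G.IsBridgelessCubic) :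
    ∃ D : DartGraph G.vertexSet, Nonempty (G.DartLabelling D) := by
  classical
  have hlab : ∀ v : G.vertexSet, ∃ l : Fin 3 → β, Function.Injective l ∧
      ∀ e, e ∈ G.incidenceSet v ↔ ∃ i, l i = e := by
    intro v
    obtain ⟨p, q, r, hpq, hpr, hqr, h⟩ := Set.ncard_eq_three.1 (hG.ncard_incidenceSet v.2)
    refine ⟨![p, q, r], ?_, fun e => ?_⟩
    · intro i j hij
      fin_cases i <;> fin_cases j <;> simp_all
    · rw [h]
      simp [Fin.exists_fin_succ, eq_comm]
  choose l hinj hrange using hlab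
  have hinv : ∀ d : G.vertexSet × Fin 3, ∃ d' : G.vertexSet × Fin 3,
      l d'.1 d'.2 = l d.1 d.2 ∧ G.IsLink (l d.1 d.2) d.1 d'.1 := by
    rintro ⟨v, i⟩
    obtain ⟨y, hy⟩ : G.Inc (l v i) v := (hrange v _).2 ⟨i, rfl⟩
    obtain ⟨j, hj⟩ := (hrange ⟨y, hy.right_mem⟩ (l v i)).1 ⟨_, hy.symm⟩
    exact ⟨(⟨y, hy.right_mem⟩, j), hj, hy⟩
  choose inv hinv₁ hinv₂ using hinv
  have hinv_inv : ∀ d, inv (inv d) = d := by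
    intro d
    have h1 := hinv₂ (inv d)
    rw [hinv₁] at h1
    have h2 : (inv (inv d)).1 = d.1 := Subtype.ext (h1.right_unique (hinv₂ d).symm)
    refine Prod.ext h2 (hinj d.1 ?_)
    rw [← h2, hinv₁, hinv₁, h2]
  have hkey : ∀ d d' : G.vertexSet × Fin 3, l d'.1 d'.2 = l d.1 d.2 → d' = d ∨ d' = inv d := by
    intro d d' h
    have h1 : G.Inc (l d.1 d.2) d'.1 := by rw [← h]; exact (hrange d'.1 _).2 ⟨_, rfl⟩
    rcases h1.eq_or_eq_of_isLink (hinv₂ d) with e | e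
    · have e' : d'.1 = d.1 := Subtype.ext e
      exact .inl (Prod.ext e' (hinj d.1 (by rw [← h, e'])))
    · have e' : d'.1 = (inv d).1 := Subtype.ext e
      exact .inr (Prod.ext e' (hinj (inv d).1 (by rw [hinv₁, ← h, e'])))
  refine ⟨⟨inv, hinv_inv, fun d e => ?_, fun d f hf => ?_⟩, ⟨⟨fun d => l d.1 d.2,
    fun v i j h => hinj v h, hrange, hinv₁, hinv₂⟩⟩⟩
  · have := hinv₂ d
    rw [e] at this
    exact hG.not_isLoopAt _ _ this
  · -- the colouring is constant on walks avoiding the exceptional edge, in particular on its ends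
    have hdel : ∀ x (hx : x ∈ G.vertexSet) y,
        (G.deleteEdges {l d.1 d.2}).Reachable x y → ∃ hy, f ⟨x, hx⟩ = f ⟨y, hy⟩ := by
      intro x hx y hxy
      induction hxy with
      | refl => exact ⟨hx, rfl⟩
      | @tail y z _ hadj ih =>
        obtain ⟨hy, ih⟩ := ih
        obtain ⟨e, he⟩ := hadj
        rw [deleteEdges_isLink] at he
        refine ⟨he.1.right_mem, ih.trans ?_⟩
        obtain ⟨i, rfl⟩ := (hrange ⟨y, hy⟩ e).1 ⟨_, he.1⟩
        have h1 := hf (⟨y, hy⟩, i) (fun e => he.2 (by rw [← e]; rfl))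
          (fun e => he.2 (by rw [← hinv₁ d, ← e]; rfl))
        rw [h1]
        congr 1
        exact Subtype.ext ((hinv₂ (⟨y, hy⟩, i)).right_unique he.1)
    have hends : f d.1 = f (inv d).1 := by
      have h1 := hG.bridgeless _ (hinv₂ d).edge_mem
      have h2 : (G.deleteEdges {l d.1 d.2}).Reachable d.1 (inv d).1 := by
        by_contra h3
        exact h1 ⟨_, _, hinv₂ d, h3⟩
      obtain ⟨_, h3⟩ := hdel _ d.1.2 _ h2
      exact h3
    have hall : ∀ z : G.vertexSet × Fin 3, f z.1 = f (inv z).1 := by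
      intro z
      by_cases h1 : z = d
      · rw [h1]; exact hends
      by_cases h2 : z = inv d
      · rw [h2, hinv_inv]; exact hends.symm
      exact hf z h1 h2
    have hreach : ∀ x (hx : x ∈ G.vertexSet) y, G.Reachable x y →
        ∃ hy, f ⟨x, hx⟩ = f ⟨y, hy⟩ := by
      intro x hx y hxy
      induction hxy with
      | refl => exact ⟨hx, rfl⟩
      | @tail y z _ hadj ih =>
        obtain ⟨hy, ih⟩ := ih
        obtain ⟨e, he⟩ := hadj
        refine ⟨he.right_mem, ih.trans ?_⟩
        obtain ⟨i, rfl⟩ := (hrange ⟨y, hy⟩ e).1 ⟨_, he⟩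
        rw [hall (⟨y, hy⟩, i)]
        congr 1
        exact Subtype.ext ((hinv₂ (⟨y, hy⟩, i)).right_unique he)
    intro u v
    obtain ⟨_, h1⟩ := hreach u u.2 v (hG.connected.2 u u.2 v v.2)
    exact h1

namespace DartLabelling

variable {D : DartGraph G.vertexSet} (L : G.DartLabelling D)

/-- The edge set selected by a choice of a dart at every vertex. -/
def edges (m : G.vertexSet → Fin 3) : Set β := {e | ∃ v, L.lab (v, m v) = e}

lemma lab_eq {d d' : G.vertexSet × Fin 3} (h : L.lab d' = L.lab d) : d' = d ∨ d' = D.inv d := by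
  have h1 : G.Inc (L.lab d) d'.1 := by rw [← h]; exact (L.range d'.1 _).2 ⟨d'.2, rfl⟩
  rcases h1.eq_or_eq_of_isLink (L.isLink d) with e | e
  · have e' : d'.1 = d.1 := Subtype.ext e
    exact .inl (Prod.ext e' (L.inj d.1 _ _ (by rw [← e', h, e'])))
  · have e' : d'.1 = (D.inv d).1 := Subtype.ext e
    exact .inr (Prod.ext e' (L.inj (D.inv d).1 _ _ (by rw [← e', h, e', L.lab_inv])))

lemma lab_mem_edges {m : G.vertexSet → Fin 3} (hm : D.IsPM m) (d : G.vertexSet × Fin 3) :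
    L.lab d ∈ L.edges m ↔ m d.1 = d.2 := by
  constructor
  · rintro ⟨v, hv⟩
    rcases L.lab_eq hv with e | e
    · rw [← e]
    · rw [← hm.iff, ← e]
  · intro h
    exact ⟨d.1, by rw [h]⟩

lemma isPerfectMatching_edges {m : G.vertexSet → Fin 3} (hG : G.IsBridgelessCubic)
    (hm : D.IsPM m) : G.IsPerfectMatching (L.edges m) := by
  refine ⟨?_, fun x hx => ?_⟩
  · rintro e ⟨v, rfl⟩
    exact (L.isLink _).edge_mem
  · have h1 : (G.restrict (L.edges m)).loopSet x = ∅ := by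
      ext e; simp [hG.not_isLoopAt]
    rw [degree, h1, Set.ncard_empty, add_zero, Set.ncard_eq_one]
    refine ⟨L.lab (⟨x, hx⟩, m ⟨x, hx⟩), ?_⟩
    ext e
    rw [mem_incidenceSet, restrict_inc, Set.mem_singleton_iff]
    constructor
    · rintro ⟨h2, h3⟩
      obtain ⟨i, rfl⟩ := (L.range ⟨x, hx⟩ e).1 h2
      rw [L.lab_mem_edges hm] at h3
      exact congrArg (fun j => L.lab (⟨x, hx⟩, j)) h3.symm
    · rintro rfl
      exact ⟨(L.range ⟨x, hx⟩ _).2 ⟨_, rfl⟩, _, rfl⟩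

lemma isS4Pair_edges {m₁ m₂ : G.vertexSet → Fin 3} (hG : G.IsBridgelessCubic)
    (hm : D.IsS4 m₁ m₂) : G.IsS4Pair (L.edges m₁) (L.edges m₂) := by
  classical
  obtain ⟨h₁, h₂, c, hc⟩ := hm
  refine ⟨L.isPerfectMatching_edges hG h₁, L.isPerfectMatching_edges hG h₂,
    fun x => if hx : x ∈ G.vertexSet then c ⟨x, hx⟩ else false, fun e x y hxy => ?_⟩
  rw [deleteEdges_isLink] at hxy
  obtain ⟨hxy, hM⟩ := hxy
  have hx := hxy.left_mem
  have hy' := hxy.right_mem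
  obtain ⟨i, rfl⟩ := (L.range ⟨x, hx⟩ e).1 ⟨_, hxy⟩
  rw [Set.mem_union, L.lab_mem_edges h₁, L.lab_mem_edges h₂, not_or] at hM
  have h := hc (⟨x, hx⟩, i) hM.1 hM.2
  simp only [dif_pos hx, dif_pos hy']
  have hy : (D.inv (⟨x, hx⟩, i)).1 = ⟨y, hy'⟩ :=
    Subtype.ext ((L.isLink _).right_unique hxy)
  rwa [hy] at h

open Classical in
lemma frequency_edges {m₁ m₂ : G.vertexSet → Fin 3} (h₁ : D.IsPM m₁) (h₂ : D.IsPM m₂)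
    (d : G.vertexSet × Fin 3) : frequency [L.edges m₁, L.edges m₂] (L.lab d) =
      (if m₁ d.1 = d.2 then 1 else 0) + (if m₂ d.1 = d.2 then 1 else 0) := by
  simp only [frequency, List.countP_cons, List.countP_nil, decide_eq_true_eq,
    L.lab_mem_edges h₁, L.lab_mem_edges h₂]
  lia

end DartLabelling

end Graph

/-! ### The equivalence -/

namespace DartGraph

/-- All frequencies with sum two can be prescribed at a vertex: the two members share an edge there,
or they use two different edges. -/
lemma exists_isS4_frequency (h : Graph.S4Conjecture) {V : Type} [Finite V] (G : DartGraph V)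
    (w : V) {a b c : Fin 3} (hab : a ≠ b) (hac : a ≠ c) (hbc : b ≠ c) {i j k : ℕ}
    (hijk : i + j + k = 2) :
    ∃ m₁ m₂, G.IsS4 m₁ m₂ ∧
      (if m₁ w = a then 1 else 0) + (if m₂ w = a then 1 else 0) = i ∧
      (if m₁ w = b then 1 else 0) + (if m₂ w = b then 1 else 0) = j ∧
      (if m₁ w = c then 1 else 0) + (if m₂ w = c then 1 else 0) = k := by
  have htwo : ∀ (W : Type) [Finite W] (H : DartGraph W) (d : W × Fin 3),
      ∃ m₁ m₂, H.IsS4 m₁ m₂ ∧ m₁ d.1 = d.2 ∧ m₂ d.1 = d.2 := fun W _ H d =>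
    exists_isS4_mem_both (fun W _ _ H => exists_isS4_of_S4Conjecture h W H) H d
  have hsame : ∀ x : Fin 3, ∃ m₁ m₂, G.IsS4 m₁ m₂ ∧ m₁ w = x ∧ m₂ w = x :=
    fun x => htwo V G (w, x)
  have hdiff : ∀ x y : Fin 3, x ≠ y →
      ∃ m₁ m₂, G.IsS4 m₁ m₂ ∧ (m₁ w = x ∧ m₂ w = y ∨ m₁ w = y ∧ m₂ w = x) :=
    fun x y hxy => exists_isS4_one_one_zero htwo G w x y hxy
  have hcases : i = 2 ∧ j = 0 ∧ k = 0 ∨ i = 0 ∧ j = 2 ∧ k = 0 ∨ i = 0 ∧ j = 0 ∧ k = 2 ∨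
      i = 1 ∧ j = 1 ∧ k = 0 ∨ i = 1 ∧ j = 0 ∧ k = 1 ∨ i = 0 ∧ j = 1 ∧ k = 1 := by lia
  rcases hcases with ⟨rfl, rfl, rfl⟩ | ⟨rfl, rfl, rfl⟩ | ⟨rfl, rfl, rfl⟩ | ⟨rfl, rfl, rfl⟩ |
    ⟨rfl, rfl, rfl⟩ | ⟨rfl, rfl, rfl⟩
  · obtain ⟨m₁, m₂, hm, h1, h2⟩ := hsame a
    exact ⟨m₁, m₂, hm, by simp [h1, h2, hab, hac]⟩
  · obtain ⟨m₁, m₂, hm, h1, h2⟩ := hsame b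
    exact ⟨m₁, m₂, hm, by simp [h1, h2, hab.symm, hbc]⟩
  · obtain ⟨m₁, m₂, hm, h1, h2⟩ := hsame c
    exact ⟨m₁, m₂, hm, by simp [h1, h2, hac.symm, hbc.symm]⟩
  · obtain ⟨m₁, m₂, hm, ⟨h1, h2⟩ | ⟨h1, h2⟩⟩ := hdiff a b hab <;>
    exact ⟨m₁, m₂, hm, by simp [h1, h2, hab, hab.symm, hac, hbc]⟩
  · obtain ⟨m₁, m₂, hm, ⟨h1, h2⟩ | ⟨h1, h2⟩⟩ := hdiff a c hac <;>
    exact ⟨m₁, m₂, hm, by simp [h1, h2, hab, hac, hac.symm, hbc.symm]⟩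
  · obtain ⟨m₁, m₂, hm, ⟨h1, h2⟩ | ⟨h1, h2⟩⟩ := hdiff b c hbc <;>
    exact ⟨m₁, m₂, hm, by simp [h1, h2, hab.symm, hac.symm, hbc, hbc.symm]⟩

end DartGraph

theorem mainTheorem8 (i j k : ℕ) (hijk : i + j + k = 2) :
    Graph.S4Conjecture ↔
      ∀ (α β : Type) (G : Graph α β), G.IsBridgelessCubic →
        ∀ w ∈ G.vertexSet, ∀ a b c : β, a ≠ b → a ≠ c → b ≠ c →
          G.incidenceSet w = {a, b, c} →
            ∃ M₁ M₂ : Set β, G.IsS4Pair M₁ M₂ ∧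
              Graph.frequency [M₁, M₂] a = i ∧
              Graph.frequency [M₁, M₂] b = j ∧
              Graph.frequency [M₁, M₂] c = k := by
  constructor
  · intro h α β G hG w hw a b c hab hac hbc hinc
    have := hG.finite_vertexSet.to_subtype
    obtain ⟨D, ⟨L⟩⟩ := hG.exists_dartLabelling
    obtain ⟨a', rfl⟩ := (L.range ⟨w, hw⟩ a).1 (by rw [hinc]; simp)
    obtain ⟨b', rfl⟩ := (L.range ⟨w, hw⟩ b).1 (by rw [hinc]; simp)
    obtain ⟨c', rfl⟩ := (L.range ⟨w, hw⟩ c).1 (by rw [hinc]; simp)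
    obtain ⟨m₁, m₂, hm, h1, h2, h3⟩ := D.exists_isS4_frequency h ⟨w, hw⟩
      (ne_of_apply_ne (fun l => L.lab (⟨w, hw⟩, l)) hab)
      (ne_of_apply_ne (fun l => L.lab (⟨w, hw⟩, l)) hac)
      (ne_of_apply_ne (fun l => L.lab (⟨w, hw⟩, l)) hbc) hijk
    refine ⟨L.edges m₁, L.edges m₂, L.isS4Pair_edges hG hm, ?_, ?_, ?_⟩
    · rw [L.frequency_edges hm.left hm.right, ← h1]
    · rw [L.frequency_edges hm.left hm.right, ← h2]
    · rw [L.frequency_edges hm.left hm.right, ← h3]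
  · intro h α β G _ hG
    obtain ⟨w, hw⟩ := hG.connected.1
    obtain ⟨a, b, c, hab, hac, hbc, hinc⟩ := Set.ncard_eq_three.1 (hG.ncard_incidenceSet hw)
    obtain ⟨M₁, M₂, hM, -⟩ := h α β G hG w hw a b c hab hac hbc hinc
    exact ⟨M₁, M₂, hM⟩
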